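/- Let $m,n\ge 1$, let $A=(a_{ij})$ and $C$ be nonzero real $m\times n$ matrices and let $\beta\in\mathbb R^n$ be a nonzero vector. Consider the game space $\Gamma=\{(A,\,C+\alpha\beta^T) : \alpha\in\mathbb R^m\}$ and the polyhedra $$P=\{(y,\pi_1)\in\mathbb R^{n}\times\mathbb R : (Ay)_i\le \pi_1\ (1\le i\le m),\ y_j\ge 0\ (1\le j\le n),\ \textstyle\sum_j y_j=1\},$$ $$Q'=\{(x,\lambda,\pi_2)\in\mathbb R^{m}\times\mathbb R\times\mathbb R : x_i\ge 0\ (1\le i\le m),\ (x^TC)_j+\beta_j\lambda\le \pi_2\ (1\le j\le n),\ \textstyle\sum_i x_i=1\}.$$ In both polyhedra number the inequalities $1,\dots,m+n$ in the order written, and let the label $L(v)$ of a point $v$ of $P$ or of $Q'$ be the set of indices of the inequalities that are tight at $v$. Assume that $P$ and $Q'$ are non-degenerate, i.e. $|L(v)|\le n$ for all $v\in P$ and $|L(w)|\le m+1$ for all $w\in Q'$. Assume also that the minimum of $\beta_1,\dots,\beta_n$ is attained at exactly one index $j_s$, that their maximum is attained at exactly one index $j_e$, and that $j_s\ne j_e$.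 Let $$\mathcal N=\{(v,w)\in P\times Q' : L(v)\cup L(w)=\{1,\dots,m+n\}\}$$ be the set of fully-labeled pairs, let $\mathcal E_v=\{w\in Q' : (v,w)\in\mathcal N\}$ for $v\in P$, and let $v_s=(e_{j_s},\max_i a_{ij_s})$ and $v_e=(e_{j_e},\max_i a_{ij_e})$, where $e_j$ is the $j$-th unit vector of $\mathbb R^n$. Then $\mathcal N=\mathcal P\cup\mathcal C_1\cup\dots\cup\mathcal C_k$ for some $k\ge 0$, where the sets $\mathcal P,\mathcal C_1,\dots,\mathcal C_k$ are mutually disjoint and are the connected components of $\mathcal N$; each $\mathcal C_i$ is a cycle on the $1$-skeleton of $P\times Q'$ (the union of the bounded edges joining cyclically consecutive members of a list of at least three distinct vertices of $P\times Q'$); and $\mathcal P$ is a bi-infinite path on the $1$-skeleton of $P\times Q'$, i.e. the union of the bounded edges joining consecutive members of a list $u_0,\dots,u_r$ of distinct vertices of $P\times Q'$ and of two different unbounded edges of $P\times Q'$, whose only bounding vertices are $u_0$ and $u_r$ respectively. These two unbounded end edges are $\{v_s\}\times\mathcal E_{v_s}$ (at $u_0$) and $\{v_e\}\times\mathcal E_{v_e}$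 (at $u_r$). -/

import Mathlib

/-! ### Edges, paths and cycles on the 1-skeleton of a polyhedron -/

namespace Polyhedral

variable {E : Type*} [NormedAddCommGroup E] [NormedSpace ℝ E]

/-- `F` is an edge of the polyhedron `S`: a nonempty face of `S` (the set of maximizers on `S` of
some linear functional) of dimension `1`.  Edges may be bounded or unbounded. -/
def IsEdge (S F : Set E) : Prop :=
  IsExposed ℝ S F ∧ F.Nonempty ∧ Module.finrank ℝ (vectorSpan ℝ F) = 1

/-- `R` is an unbounded edge of `S` with exactly one bounding vertex, namely `u`. -/
def IsRayEdge (S : Set E) (u : E) (R : Set E) : Prop :=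
  IsEdge S R ∧ u ∈ S.extremePoints ℝ ∧ ∃ d : E, d ≠ 0 ∧ R = (fun t : ℝ => u + t • d) '' Set.Ici 0

/-- `Z` is a bi-infinite path on the 1-skeleton of `S` with unbounded end edges `Rs` and `Re`:
there are distinct vertices `u 0, …, u k` of `S`, consecutive ones joined by an edge of `S`, and
`Z` is the union of these `k` bounded edges, of the unbounded edge `Rs` starting at `u 0`, and of
the (different) unbounded edge `Re` starting at `u k`. -/
def IsBiinfinitePath (S Rs Re Z : Set E) : Prop :=
  ∃ (k : ℕ) (u : Fin (k + 1) → E),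
    Function.Injective u ∧
    (∀ i, u i ∈ S.extremePoints ℝ) ∧
    (∀ i : Fin k, IsEdge S (segment ℝ (u i.castSucc) (u i.succ))) ∧
    IsRayEdge S (u 0) Rs ∧
    IsRayEdge S (u (Fin.last k)) Re ∧
    Rs ≠ Re ∧
    Z = Rs ∪ (⋃ i : Fin k, segment ℝ (u i.castSucc) (u i.succ)) ∪ Re

/-- `Z` is a cycle on the 1-skeleton of `S`: the union of the edges joining cyclically consecutive
vertices in a list of at least three distinct vertices of `S`.  The addition `i + 1` in
`Fin (k + 3)` wraps around. -/
def IsEdgeCycle (S Z : Set E) : Prop :=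
  ∃ (k : ℕ) (u : Fin (k + 3) → E),
    Function.Injective u ∧
    (∀ i, u i ∈ S.extremePoints ℝ) ∧
    (∀ i, IsEdge S (segment ℝ (u i) (u (i + 1)))) ∧
    Z = ⋃ i, segment ℝ (u i) (u (i + 1))

end Polyhedral

/-- The data of a game space `Γ = {(A, C + α βᵀ) | α ∈ ℝᵐ}` of `m × n` bimatrix games, where `A`
and `C` are nonzero matrices and `β` is a nonzero vector (so that, in particular, `m, n ≥ 1`). -/
structure GameSpace (m n : ℕ) where
  /-- the fixed payoff matrix of the row-player -/
  A : Matrix (Fin m) (Fin n) ℝ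
  /-- the base payoff matrix of the column-player -/
  C : Matrix (Fin m) (Fin n) ℝ
  /-- the direction vector -/
  β : Fin n → ℝ
  A_ne_zero : A ≠ 0
  C_ne_zero : C ≠ 0
  β_ne_zero : β ≠ 0

namespace GameSpace

variable {m n : ℕ} (G : GameSpace m n)

/-- The best response polytope `P` of the row-player, with points `(y, π₁)`. -/
def P : Set ((Fin n → ℝ) × ℝ) :=
  {v | (∀ i, (G.A.mulVec v.1) i ≤ v.2) ∧ (∀ j, 0 ≤ v.1 j) ∧ ∑ j, v.1 j = 1}

/-- The polyhedron `Q'`, with points `(x, λ, π₂)`. -/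
def Q' : Set ((Fin m → ℝ) × ℝ × ℝ) :=
  {w | (∀ i, 0 ≤ w.1 i) ∧ (∀ j, (Matrix.vecMul w.1 G.C) j + G.β j * w.2.1 ≤ w.2.2) ∧
    ∑ i, w.1 i = 1}

/-- The label of a point of `P`: the set of indices of the inequalities tight at it.  The `m`
inequalities of the row-player are indexed by `Fin m`, the `n` inequalities of the column-player
by `Fin n`. -/
def labelP (v : (Fin n → ℝ) × ℝ) : Set (Fin m ⊕ Fin n) :=
  {l | Sum.elim (fun i => (G.A.mulVec v.1) i = v.2) (fun j => v.1 j = 0) l}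

/-- The label of a point of `Q'`: the set of indices of the inequalities tight at it. -/
def labelQ' (w : (Fin m → ℝ) × ℝ × ℝ) : Set (Fin m ⊕ Fin n) :=
  {l | Sum.elim (fun i => w.1 i = 0)
    (fun j => (Matrix.vecMul w.1 G.C) j + G.β j * w.2.1 = w.2.2) l}

/-- `P`, which has dimension `n`, is non-degenerate: no point of `P` has more than `n` labels. -/
def NondegenerateP : Prop := ∀ v ∈ G.P, (G.labelP v).ncard ≤ n

/-- `Q'`, which has dimension `m + 1`, is non-degenerate: no point of `Q'` has more than `m + 1`
labels. -/
def NondegenerateQ' : Prop := ∀ w ∈ G.Q', (G.labelQ' w).ncard ≤ m + 1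

/-- The set `𝒩` of fully-labeled pairs in `P × Q'`. -/
def N : Set (((Fin n → ℝ) × ℝ) × ((Fin m → ℝ) × ℝ × ℝ)) :=
  {p | p.1 ∈ G.P ∧ p.2 ∈ G.Q' ∧ G.labelP p.1 ∪ G.labelQ' p.2 = Set.univ}

/-- The set `ℰ_v` of the points of `Q'` that form a fully-labeled pair with `v`. -/
def fiber (v : (Fin n → ℝ) × ℝ) : Set ((Fin m → ℝ) × ℝ × ℝ) :=
  {w | (v, w) ∈ G.N}

/-- The point `(e_j, maxᵢ a_{ij})` of `P`, where the column-player uses the pure strategy `j`.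
(For `j` minimizing, respectively maximizing, `β` this is `v_s`, respectively `v_e`.) -/
noncomputable def pureVertex (j : Fin n) : (Fin n → ℝ) × ℝ :=
  (Pi.single j 1, ⨆ i, G.A i j)

end GameSpace

/-! Each of the m + n labels is carried by two inequalities of P × Q', one from each factor, and P ×
Q' has dimension one more than the number of labels. A fully-labeled pair has a tight inequality for
every label, so 𝒩 is the union of the faces `choiceFace τ`, where τ selects one of the two
inequalities for each label. Non-degeneracy makes the inequalities that are tight at a point
linearly independent (`evalDir_tight_surjective`), so such a face, if nonempty, is an edge: a
segment or a ray (`IsVertex.choiceFace_eq`). At a vertex in 𝒩 exactly one label is carried twice;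
dropping either copy gives the two edges of 𝒩 there. Hence 𝒩 is a graph of degree two, apart from
its unbounded edges.

The choices of the two edges at a vertex differ at one label, hence in the parity of the number of
labels taken from P. Moving along the edge of a fixed parity is therefore an involution on the
vertices, except at rays. A ray of 𝒩 can change only λ and π₂; as λ tends to ±∞ the single best
column is the one with extreme β, so there are just two rays, over v_s and v_e
(`eq_pureChoice_of_ray`). Both take n labels from P (`parity_pureChoice`), so they have the same
parity and may be glued into one artificial link.

This leaves two fixed-point-free involutions of a finite set, whose joint orbits are even cycles
(`exists_altSeq_cycle`). The orbit through the artificial link, cut open there, is the path; the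
others are cycles, of length at least four because two edges share at most one point. The orbits
give finitely many disjoint closed connected sets, which are thus the components of 𝒩
(`part_eq_comp`). -/

namespace Polyhedral

/-! ### Faces, vertices and edges of polyhedra in general position. -/

open Module

/-- A polyhedron in general position: it is cut out of a translate of the subspace `dir` by the
inequalities `g i x ≤ b i`, contains no line, and no point of it satisfies more than
`finrank dir` of the inequalities with equality. -/
structure SimplePolyhedron (V ι : Type*) [NormedAddCommGroup V] [NormedSpace ℝ V] where
  /-- the points of the polyhedron -/
  carrier : Set V
  /-- the direction of the affine subspace that contains the polyhedron -/
  dir : Submodule ℝ V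
  /-- the left hand sides of the inequalities -/
  g : ι → V →ₗ[ℝ] ℝ
  /-- the right hand sides of the inequalities -/
  b : ι → ℝ
  mem_iff : ∀ x ∈ carrier, ∀ y, y ∈ carrier ↔ y - x ∈ dir ∧ ∀ i, g i y ≤ b i
  pointed : ∀ d ∈ dir, (∀ i, g i d = 0) → d = 0
  card_le : ∀ x ∈ carrier, {i | g i x = b i}.ncard ≤ finrank ℝ dir

namespace SimplePolyhedron

variable {V ι : Type*} [NormedAddCommGroup V] [NormedSpace ℝ V] (S : SimplePolyhedron V ι)

/-- The inequalities that hold with equality at `x`. -/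
def tight (x : V) : Set ι := {i | S.g i x = S.b i}

/-- The face where the inequalities in `T` hold with equality. -/
def face (T : Set ι) : Set V := {x ∈ S.carrier | T ⊆ S.tight x}

variable {S}

theorem le_of_mem {x : V} (hx : x ∈ S.carrier) (i : ι) : S.g i x ≤ S.b i :=
  ((S.mem_iff x hx x).1 hx).2 i

theorem sub_mem {x y : V} (hx : x ∈ S.carrier) (hy : y ∈ S.carrier) : y - x ∈ S.dir :=
  ((S.mem_iff x hx y).1 hy).1

theorem add_smul_mem_iff {x d : V} (hx : x ∈ S.carrier) (hd : d ∈ S.dir) (t : ℝ) :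
    x + t • d ∈ S.carrier ↔ ∀ i, S.g i x + t * S.g i d ≤ S.b i := by
  rw [S.mem_iff x hx]
  simp [S.dir.smul_mem t hd]

theorem mem_tight_add_smul {x d : V} {t : ℝ} {i : ι} :
    i ∈ S.tight (x + t • d) ↔ S.g i x + t * S.g i d = S.b i := by
  simp [tight]

theorem convex_carrier : Convex ℝ S.carrier := by
  intro x hx y hy p q hp hq hpq
  have h : p • x + q • y = x + q • (y - x) := by
    rw [← eq_sub_iff_add_eq] at hpq
    rw [hpq]; module
  rw [h, add_smul_mem_iff hx (sub_mem hx hy)]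
  intro i
  have h1 := le_of_mem hx i
  have h2 := le_of_mem hy i
  rw [map_sub]
  nlinarith

theorem convex_face (T : Set ι) : Convex ℝ (S.face T) := by
  intro x hx y hy p q hp hq hpq
  refine ⟨convex_carrier hx.1 hy.1 hp hq hpq, fun i hi => ?_⟩
  have h1 : S.g i x = S.b i := hx.2 hi
  have h2 : S.g i y = S.b i := hy.2 hi
  change S.g i _ = S.b i
  simp only [map_add, map_smul, smul_eq_mul, h1, h2]
  rw [← add_mul, hpq, one_mul]

/-- The exposing functional is the sum of the left hand sides over `T`: on a nonempty face it
attains the sum of the bounds, and it does so only where each summand is tight. -/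
theorem isExposed_face [Finite ι] [FiniteDimensional ℝ V] (T : Set ι) :
    IsExposed ℝ S.carrier (S.face T) := by
  classical
  rintro ⟨z, hz⟩
  have := Fintype.ofFinite ι
  refine ⟨LinearMap.toContinuousLinearMap (∑ i ∈ T.toFinset, S.g i), ?_⟩
  have key : ∀ y, (LinearMap.toContinuousLinearMap (∑ i ∈ T.toFinset, S.g i)) y
      = ∑ i ∈ T.toFinset, S.g i y := by intro y; simp
  have hle : ∀ y ∈ S.carrier, ∑ i ∈ T.toFinset, S.g i y ≤ ∑ i ∈ T.toFinset, S.b i :=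
    fun y hy => Finset.sum_le_sum fun i _ => le_of_mem hy i
  have heq : ∀ y ∈ S.face T, ∑ i ∈ T.toFinset, S.g i y = ∑ i ∈ T.toFinset, S.b i :=
    fun y hy => Finset.sum_congr rfl fun i hi => hy.2 (by simpa using hi)
  ext x
  simp only [key, Set.mem_ofPred_eq]
  constructor
  · intro hx
    exact ⟨hx.1, fun y hy => (hle y hy).trans (heq x hx).ge⟩
  · rintro ⟨hx, hmax⟩
    refine ⟨hx, fun i hi => ?_⟩
    have h1 := le_antisymm (hle x hx) ((heq z hz).symm.le.trans (hmax z hz.1))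
    exact (Finset.sum_eq_sum_iff_of_le fun i _ => le_of_mem hx i).1 h1 i (by simpa using hi)

theorem isClosed_face [FiniteDimensional ℝ V] (T : Set ι) : IsClosed (S.face T) := by
  rcases (S.face T).eq_empty_or_nonempty with h | ⟨z, hz⟩
  · rw [h]; exact isClosed_empty
  have : S.face T = {x | x - z ∈ S.dir} ∩ ({x | ∀ i, S.g i x ≤ S.b i} ∩
      {x | ∀ i ∈ T, S.g i x = S.b i}) := by
    ext x
    simp only [face, Set.mem_ofPred_eq, Set.mem_inter_iff, S.mem_iff z hz.1 x, and_assoc]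
    rfl
  rw [this]
  have hg : ∀ i, Continuous (S.g i) := fun i => (S.g i).continuous_of_finiteDimensional
  refine IsClosed.inter ?_ (IsClosed.inter ?_ ?_)
  · exact S.dir.closed_of_finiteDimensional.preimage (by fun_prop)
  · simp only [Set.ofPred_forall]
    exact isClosed_iInter fun i => isClosed_le (hg i) continuous_const
  · simp only [Set.ofPred_forall]
    exact isClosed_iInter fun i => isClosed_iInter fun _ => isClosed_eq (hg i) continuous_const

/-- Walking from `x` in a direction that leaves no tight inequality, one either never leaves the
polyhedron or stops where a further inequality becomes tight. -/
theorem exists_step [Finite ι] {x d : V} (hx : x ∈ S.carrier) (hd : d ∈ S.dir)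
    (hxd : ∀ i ∈ S.tight x, S.g i d ≤ 0) (hpos : ∃ i, 0 < S.g i d) :
    ∃ t : ℝ, 0 < t ∧ x + t • d ∈ S.carrier ∧ ∃ j, 0 < S.g j d ∧ j ∈ S.tight (x + t • d) := by
  -- Ratio test: the quotient is the time at which inequality `i` becomes tight, and the earliest
  -- one stops the walk.
  obtain ⟨j, hj, hmin⟩ := Set.exists_min_image {i | 0 < S.g i d}
    (fun i => (S.b i - S.g i x) / S.g i d) (Set.toFinite _) hpos
  have hj : 0 < S.g j d := hj
  have hlt : S.g j x < S.b j := by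
    refine lt_of_le_of_ne (le_of_mem hx j) fun h => ?_
    exact absurd (hxd j h) (not_le.2 hj)
  have ht : 0 < (S.b j - S.g j x) / S.g j d := div_pos (sub_pos.2 hlt) hj
  refine ⟨_, ht, ?_, j, hj, ?_⟩
  · rw [add_smul_mem_iff hx hd]
    intro i
    rcases le_or_gt (S.g i d) 0 with h | h
    · have := le_of_mem hx i
      nlinarith
    · have := hmin i h
      rw [le_div_iff₀ h] at this
      linarith
  · rw [mem_tight_add_smul]
    field_simp
    ring

/-- Since there is no line in the polyhedron, some inequality varies along `d`; after a change of
sign it increases, so the walk stops, with all old inequalities still tight. This drives the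
inductions on the number of slack inequalities. -/
theorem exists_step_ssubset [Finite ι] {x d : V} (hx : x ∈ S.carrier) (hd : d ∈ S.dir)
    (h0 : d ≠ 0) (hxd : ∀ i ∈ S.tight x, S.g i d = 0) :
    ∃ y ∈ S.carrier, S.tight x ⊂ S.tight y := by
  obtain ⟨i, hi⟩ : ∃ i, S.g i d ≠ 0 := by
    by_contra! h
    exact h0 (S.pointed d hd h)
  obtain ⟨d', hd', hi', hxd'⟩ : ∃ d' ∈ S.dir, 0 < S.g i d' ∧ ∀ i ∈ S.tight x, S.g i d' = 0 := by
    rcases lt_or_gt_of_ne hi with h | h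
    · exact ⟨-d, S.dir.neg_mem hd, by simpa using h, fun i hi => by simp [hxd i hi]⟩
    · exact ⟨d, hd, h, hxd⟩
  obtain ⟨t, -, hmem, j, hj, hjt⟩ := exists_step hx hd' (fun i hi => (hxd' i hi).le) ⟨i, hi'⟩
  refine ⟨_, hmem, Set.ssubset_iff_exists.2 ⟨fun k hk => ?_, j, hjt, fun hjx => ?_⟩⟩
  · rw [mem_tight_add_smul, hxd' k hk, mul_zero, add_zero]
    exact hk
  · exact absurd (hxd' j hjx) hj.ne'

/-- Evaluation of the inequalities in `T` on the directions of the polyhedron. -/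
def evalDir (S : SimplePolyhedron V ι) (T : Set ι) : S.dir →ₗ[ℝ] (T → ℝ) :=
  LinearMap.pi fun i => (S.g i).comp S.dir.subtype

theorem evalDir_eq_zero_iff {T : Set ι} {d : S.dir} :
    S.evalDir T d = 0 ↔ ∀ i ∈ T, S.g i d = 0 := by
  simp [evalDir, funext_iff]

section

variable [Finite ι] [FiniteDimensional ℝ V]

theorem finrank_tight (T : Set ι) : finrank ℝ (T → ℝ) = T.ncard := by
  have := Fintype.ofFinite T
  rw [finrank_fintype_fun_eq_card, ← Nat.card_eq_fintype_card, Nat.card_coe_set_eq]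

theorem exists_dir_of_ncard_lt {T : Set ι} (h : T.ncard < finrank ℝ S.dir) :
    ∃ d ∈ S.dir, d ≠ 0 ∧ ∀ i ∈ T, S.g i d = 0 := by
  have h' : finrank ℝ (T → ℝ) < finrank ℝ S.dir := by rwa [finrank_tight]
  obtain ⟨d, hd, hd0⟩ := Submodule.exists_mem_ne_zero_of_ne_bot
    (LinearMap.ker_ne_bot_of_finrank_lt (f := S.evalDir T) h')
  exact ⟨d, d.2, by simpa using hd0, evalDir_eq_zero_iff.1 hd⟩

/-- The tight inequalities at a point are independent. -/
theorem evalDir_tight_surjective {x : V} (hx : x ∈ S.carrier) :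
    Function.Surjective (S.evalDir (S.tight x)) := by
  induction hk : (S.tight x)ᶜ.ncard using Nat.strong_induction_on generalizing x with
  | _ k ih =>
  -- If only zero is annihilated, `card_le` forces a bijection. Otherwise walk to a point with more
  -- tight inequalities, whose independence is inherited by the subset.
  by_cases hinj : ∀ d ∈ S.dir, (∀ i ∈ S.tight x, S.g i d = 0) → d = 0
  · have hi : Function.Injective (S.evalDir (S.tight x)) := by
      rw [injective_iff_map_eq_zero]
      intro d hd
      exact Subtype.ext (hinj d d.2 (evalDir_eq_zero_iff.1 hd))
    have h1 : finrank ℝ S.dir ≤ finrank ℝ (S.tight x → ℝ) :=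
      LinearMap.finrank_le_finrank_of_injective hi
    have h2 : finrank ℝ (S.tight x → ℝ) ≤ finrank ℝ S.dir := by
      rw [finrank_tight]; exact S.card_le x hx
    exact (LinearMap.injective_iff_surjective_of_finrank_eq_finrank (le_antisymm h1 h2)).1 hi
  · push Not at hinj
    obtain ⟨d, hd, hxd, h0⟩ := hinj
    obtain ⟨y, hy, hss⟩ := exists_step_ssubset hx hd h0 hxd
    have hlt : (S.tight y)ᶜ.ncard < k := by
      rw [← hk]
      exact Set.ncard_lt_ncard (compl_lt_compl_iff_lt.2 hss)
    intro c
    classical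
    obtain ⟨e, he⟩ := ih _ hlt hy rfl
      (fun i => if h : (i : ι) ∈ S.tight x then c ⟨i, h⟩ else 0)
    refine ⟨e, funext fun i => ?_⟩
    exact (congrFun he ⟨i, hss.1 i.2⟩).trans (by simp)

/-- A point with as many tight inequalities as the dimension. -/
def IsVertex (S : SimplePolyhedron V ι) (x : V) : Prop :=
  x ∈ S.carrier ∧ (S.tight x).ncard = finrank ℝ S.dir

omit [Finite ι] [FiniteDimensional ℝ V] in
theorem isVertex_of_le {x : V} (hx : x ∈ S.carrier) (h : finrank ℝ S.dir ≤ (S.tight x).ncard) :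
    S.IsVertex x := ⟨hx, le_antisymm (S.card_le x hx) h⟩

/-- At a vertex the surjection `evalDir` is between spaces of equal dimension, hence injective. -/
theorem IsVertex.eq_zero {x d : V} (h : S.IsVertex x) (hd : d ∈ S.dir)
    (hxd : ∀ i ∈ S.tight x, S.g i d = 0) : d = 0 := by
  have h1 := (LinearMap.injective_iff_surjective_of_finrank_eq_finrank
    (by rw [finrank_tight, h.2])).2 (evalDir_tight_surjective h.1)
  have := h1 (a₁ := ⟨d, hd⟩) (a₂ := 0) (by rw [map_zero, evalDir_eq_zero_iff]; exact hxd)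
  simpa using this

theorem IsVertex.eq_of_subset {x y : V} (h : S.IsVertex x) (hy : y ∈ S.carrier)
    (hxy : S.tight x ⊆ S.tight y) : y = x := by
  refine sub_eq_zero.1 (h.eq_zero (sub_mem h.1 hy) fun i hi => ?_)
  have h1 : S.g i x = S.b i := hi
  have h2 : S.g i y = S.b i := hxy hi
  rw [map_sub, h1, h2, sub_self]

theorem IsVertex.mem_extremePoints {x : V} (h : S.IsVertex x) :
    x ∈ S.carrier.extremePoints ℝ := by
  have hf : S.face (S.tight x) = {x} := by
    ext y
    constructor
    · intro hy; exact h.eq_of_subset hy.1 hy.2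
    · rintro rfl; exact ⟨h.1, le_rfl⟩
  have := (isExposed_face (S := S) (S.tight x)).isExtreme
  rwa [hf, isExtreme_singleton] at this

/-- Relaxing one tight inequality at a vertex leads along an edge, which is a ray or ends at
another vertex. -/
theorem IsVertex.face_diff_singleton {x : V} (h : S.IsVertex x) {e : ι} (he : e ∈ S.tight x) :
    (∃ d, d ≠ 0 ∧ S.face (S.tight x \ {e}) = (fun t : ℝ => x + t • d) '' Set.Ici 0) ∨
    ∃ y, S.IsVertex y ∧ y ≠ x ∧ S.face (S.tight x \ {e}) = segment ℝ x y := by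
  classical
  -- The direction of the edge: by independence it can loosen `e` at unit speed and keep the other
  -- tight inequalities.
  obtain ⟨⟨d, hd⟩, hde⟩ := evalDir_tight_surjective h.1
    (fun i => if (i : ι) = e then -1 else 0)
  have hde : ∀ i ∈ S.tight x, S.g i d = if i = e then -1 else 0 :=
    fun i hi => congrFun hde ⟨i, hi⟩
  have hgo : S.g e d = -1 := by simpa using hde e he
  have hgz : ∀ i ∈ S.tight x \ {e}, S.g i d = 0 := fun i hi => by
    simpa [show i ≠ e from hi.2] using hde i hi.1
  have h0 : d ≠ 0 := by rintro rfl; simp at hgo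
  have hform : ∀ y ∈ S.face (S.tight x \ {e}), ∃ s : ℝ, 0 ≤ s ∧ y = x + s • d := by
    intro y hy
    -- As `e` loosens at unit speed, its slack at `y` is the parameter along the edge.
    refine ⟨S.b e - S.g e y, sub_nonneg.2 (le_of_mem hy.1 e), ?_⟩
    have hz : (y - x) - (S.b e - S.g e y) • d = 0 := by
      refine h.eq_zero (S.dir.sub_mem (sub_mem h.1 hy.1) (S.dir.smul_mem _ hd)) fun i hi => ?_
      have h1 : S.g i x = S.b i := hi
      by_cases hie : i = e
      · subst hie
        simp [h1, hgo]
      · have h2 : S.g i y = S.b i := hy.2 ⟨hi, hie⟩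
        simp [h1, h2, hgz i ⟨hi, hie⟩]
    rw [sub_eq_zero] at hz
    rw [← hz]; abel
  have htight : ∀ s : ℝ, S.tight x \ {e} ⊆ S.tight (x + s • d) := fun s i hi => by
    rw [mem_tight_add_smul, hgz i hi, mul_zero, add_zero]
    exact hi.1
  by_cases hpos : ∃ i, 0 < S.g i d
  · right
    obtain ⟨t, ht, hmem, j, hj, hjt⟩ := exists_step h.1 hd (fun i hi => by
      rw [hde i hi]; split_ifs <;> norm_num) hpos
    have hjx : j ∉ S.tight x := fun hjx => by
      have := hde j hjx
      split_ifs at this <;> linarith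
    have hne : x + t • d ≠ x := by simp [ht.ne', h0]
    refine ⟨x + t • d, isVertex_of_le hmem ?_, hne, ?_⟩
    · rw [← h.2, ← Set.ncard_exchange hjx he]
      exact Set.ncard_le_ncard (Set.insert_subset hjt (htight t))
    · refine subset_antisymm (fun y hy => ?_)
        ((convex_face _).segment_subset ⟨h.1, Set.sdiff_subset⟩ ⟨hmem, htight t⟩)
      obtain ⟨s, hs, rfl⟩ := hform y hy
      have hst : s ≤ t := by
        have h1 := (add_smul_mem_iff h.1 hd s).1 hy.1 j
        rw [mem_tight_add_smul] at hjt
        nlinarith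
      rw [segment_eq_image']
      refine ⟨s / t, ⟨by positivity, (div_le_one ht).2 hst⟩, ?_⟩
      simp [smul_smul, div_mul_cancel₀ _ ht.ne']
  · left
    push Not at hpos
    refine ⟨d, h0, subset_antisymm (fun y hy => ?_) ?_⟩
    · obtain ⟨s, hs, rfl⟩ := hform y hy
      exact ⟨s, hs, rfl⟩
    · rintro _ ⟨s, hs, rfl⟩
      have hs : 0 ≤ s := hs
      refine ⟨(add_smul_mem_iff h.1 hd s).2 fun i => ?_, htight s⟩
      have := le_of_mem h.1 i
      have := hpos i
      nlinarith

/-- Every nonempty face contains a vertex. -/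
theorem exists_isVertex_superset {x : V} (hx : x ∈ S.carrier) :
    ∃ y, S.IsVertex y ∧ S.tight x ⊆ S.tight y := by
  induction hk : (S.tight x)ᶜ.ncard using Nat.strong_induction_on generalizing x with
  | _ k ih =>
  by_cases hv : finrank ℝ S.dir ≤ (S.tight x).ncard
  · exact ⟨x, isVertex_of_le hx hv, le_rfl⟩
  · obtain ⟨d, hd, h0, hxd⟩ := exists_dir_of_ncard_lt (not_le.1 hv)
    obtain ⟨y, hy, hss⟩ := exists_step_ssubset hx hd h0 hxd
    obtain ⟨z, hz, hyz⟩ := ih _ (by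
      rw [← hk]; exact Set.ncard_lt_ncard (compl_lt_compl_iff_lt.2 hss)) hy rfl
    exact ⟨z, hz, hss.1.trans hyz⟩

end

end SimplePolyhedron

end Polyhedral

/-! ### Orbits of two fixed-point-free involutions. -/

namespace Polyhedral

/-- The relation that links `x` to `a x` and `b x`. -/
def Linked {X : Type*} (a b : X → X) (x y : X) : Prop := y = a x ∨ y = b x

/-- The sequence `x, b x, a (b x), b (a (b x)), …`. -/
def altSeq {X : Type*} (a b : X → X) (x : X) : ℕ → X
  | 0 => x
  | i + 1 => if Even i then b (altSeq a b x i) else a (altSeq a b x i)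

section

variable {X : Type*} {a b : X → X} {x : X}

theorem altSeq_succ_of_even {i : ℕ} (h : Even i) :
    altSeq a b x (i + 1) = b (altSeq a b x i) := by simp [altSeq, h]

theorem altSeq_succ_of_not_even {i : ℕ} (h : ¬ Even i) :
    altSeq a b x (i + 1) = a (altSeq a b x i) := by simp [altSeq, h]

theorem altSeq_two_mul (i : ℕ) : altSeq a b x (2 * i) = (a ∘ b)^[i] x := by
  induction i with
  | zero => rfl
  | succ i ih =>
    rw [Function.iterate_succ_apply', mul_add, mul_one,
      altSeq_succ_of_not_even (i := 2 * i + 1) (by simp),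
      altSeq_succ_of_even (by simp), ih]
    rfl

variable (ha : Function.Involutive a) (hb : Function.Involutive b) (ha' : ∀ x, a x ≠ x)
  (hb' : ∀ x, b x ≠ x)

include ha hb ha' hb' in
-- In a coincidence at odd distance, the step out of the first index and the step into the last use
-- the same involution. Cancelling it shortens the distance by two, until two neighbours agree and
-- give a fixed point.
theorem altSeq_ne_add_odd (k i : ℕ) : altSeq a b x i ≠ altSeq a b x (i + 2 * k + 1) := by
  induction k generalizing i with
  | zero =>
    by_cases h : Even i
    · simpa [altSeq_succ_of_even h] using (hb' _).symm
    · simpa [altSeq_succ_of_not_even h] using (ha' _).symm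
  | succ k ih =>
    intro h
    apply ih (i + 1)
    rw [show i + 2 * (k + 1) + 1 = (i + 1 + 2 * k + 1) + 1 by ring] at h
    by_cases he : Even i
    · rw [altSeq_succ_of_even he, h, altSeq_succ_of_even, hb]
      rw [show i + 1 + 2 * k + 1 = i + 2 * (k + 1) by ring]
      exact he.add (by simp)
    · rw [altSeq_succ_of_not_even he, h, altSeq_succ_of_not_even, ha]
      rw [show i + 1 + 2 * k + 1 = i + 2 * (k + 1) by ring, Nat.even_add]
      simp [he]

include ha hb ha' hb' in
/-- Two involutions without fixed points arrange the orbit of a point of a finite set in a cycle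
of even length. -/
theorem exists_altSeq_cycle [Finite X] (x : X) :
    ∃ p, 0 < p ∧ altSeq a b x (2 * p) = x ∧
      (∀ i j, i < 2 * p → j < 2 * p → altSeq a b x i = altSeq a b x j → i = j) ∧
      ∀ y, Relation.EqvGen (Linked a b) x y ↔ ∃ i, i < 2 * p ∧ altSeq a b x i = y := by
  have hc : Function.Injective (a ∘ b) := ha.injective.comp hb.injective
  have hper : x ∈ Function.periodicPts (a ∘ b) := hc.mem_periodicPts x
  have hp := Function.minimalPeriod_pos_of_mem_periodicPts hper
  set p := Function.minimalPeriod (a ∘ b) x with hpdef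
  have hret : altSeq a b x (2 * p) = x := by
    rw [altSeq_two_mul]; exact Function.iterate_minimalPeriod
  have heven : ∀ i j, i < p → j < p → altSeq a b x (2 * i) = altSeq a b x (2 * j) → i = j := by
    intro i j hi hj h
    rw [altSeq_two_mul, altSeq_two_mul] at h
    exact Function.iterate_injOn_Iio_minimalPeriod hi hj h
  refine ⟨p, hp, hret, fun i j hi hj h => ?_, fun y => ⟨fun h => ?_, ?_⟩⟩
  · rcases Nat.even_or_odd' i with ⟨i', rfl | rfl⟩ <;>
    rcases Nat.even_or_odd' j with ⟨j', rfl | rfl⟩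
    · rw [heven i' j' (by omega) (by omega) h]
    · exfalso
      rcases le_or_gt i' j' with hij | hij
      · apply altSeq_ne_add_odd ha hb ha' hb' (j' - i') (2 * i') (x := x)
        rw [h]; congr 1; omega
      · apply altSeq_ne_add_odd ha hb ha' hb' (i' - j' - 1) (2 * j' + 1) (x := x)
        rw [← h]; congr 1; omega
    · exfalso
      rcases le_or_gt j' i' with hij | hij
      · apply altSeq_ne_add_odd ha hb ha' hb' (i' - j') (2 * j') (x := x)
        rw [← h]; congr 1; omega
      · apply altSeq_ne_add_odd ha hb ha' hb' (j' - i' - 1) (2 * i' + 1) (x := x)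
        rw [h]; congr 1; omega
    · rw [altSeq_succ_of_even (by simp), altSeq_succ_of_even (by simp)] at h
      rw [heven i' j' (by omega) (by omega) (hb.injective h)]
  · have hclosed : ∀ y z, Linked a b y z →
        ((∃ i, i < 2 * p ∧ altSeq a b x i = y) → ∃ i, i < 2 * p ∧ altSeq a b x i = z) := by
      rintro _ z hyz ⟨i, hi, rfl⟩
      rcases Nat.even_or_odd' i with ⟨i', rfl | rfl⟩
      · rcases hyz with rfl | rfl
        · rcases Nat.eq_zero_or_pos i' with rfl | hi'
          · refine ⟨2 * p - 1, by omega, ha.injective ?_⟩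
            rw [← altSeq_succ_of_not_even (a := a) (b := b) (x := x) (i := 2 * p - 1)
              (by rw [Nat.even_sub (by omega)]; simp), ha, show 2 * p - 1 + 1 = 2 * p by omega, hret]
            rfl
          · refine ⟨2 * i' - 1, by omega, ha.injective ?_⟩
            rw [← altSeq_succ_of_not_even (a := a) (b := b) (x := x) (i := 2 * i' - 1)
              (by rw [Nat.even_sub (by omega)]; simp), ha, show 2 * i' - 1 + 1 = 2 * i' by omega]
        · exact ⟨2 * i' + 1, by omega, altSeq_succ_of_even (by simp)⟩
      · rcases hyz with rfl | rfl
        · by_cases hlast : 2 * i' + 1 + 1 < 2 * p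
          · exact ⟨2 * i' + 1 + 1, hlast, altSeq_succ_of_not_even (by simp)⟩
          · refine ⟨0, by omega, ?_⟩
            rw [← altSeq_succ_of_not_even (a := a) (b := b) (x := x) (i := 2 * i' + 1) (by simp),
              show 2 * i' + 1 + 1 = 2 * p by omega, hret]
            rfl
        · exact ⟨2 * i', by omega, by rw [altSeq_succ_of_even (by simp), hb]⟩
    have hsymm : ∀ y z, Linked a b y z → Linked a b z y := by
      rintro y z (rfl | rfl)
      · exact Or.inl (ha y).symm
      · exact Or.inr (hb y).symm
    have hiff : ∀ y z, Relation.EqvGen (Linked a b) y z →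
        ((∃ i, i < 2 * p ∧ altSeq a b x i = y) ↔ ∃ i, i < 2 * p ∧ altSeq a b x i = z) := by
      intro y z h
      induction h with
      | rel y z h => exact ⟨hclosed _ _ h, hclosed _ _ (hsymm _ _ h)⟩
      | refl => rfl
      | symm _ _ _ ih => exact ih.symm
      | trans _ _ _ _ _ ih1 ih2 => exact ih1.trans ih2
    exact (hiff x y h).1 ⟨0, by omega, rfl⟩
  · rintro ⟨i, -, rfl⟩
    induction i with
    | zero => exact .refl _
    | succ i ih =>
      refine .trans _ _ _ ih (.rel _ _ ?_)
      by_cases h : Even i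
      · exact Or.inr (altSeq_succ_of_even h)
      · exact Or.inl (altSeq_succ_of_not_even h)

end

end Polyhedral

/-! ### From paired edges to paths, cycles and connected components. -/

namespace Polyhedral

/-- A set `N` on the 1-skeleton of `C` that is made up of two edges `A x` and `B x` at every
vertex `x`, arranged by two involutions `a` and `b`: the other end of `B x` is `b x`, and the other
end of `A x` is `a x`, except that `A xs` and `A xe` are unbounded. -/
structure EdgePairing {V : Type*} [NormedAddCommGroup V] [NormedSpace ℝ V]
    (C N : Set V) (X : Type*) where
  /-- the position of a vertex -/
  pt : X → V
  /-- the edge of the first kind at a vertex -/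
  A : X → Set V
  /-- the edge of the second kind at a vertex -/
  B : X → Set V
  /-- the involution along edges of the first kind -/
  a : X → X
  /-- the involution along edges of the second kind -/
  b : X → X
  /-- the vertex of the first unbounded edge -/
  xs : X
  /-- the vertex of the second unbounded edge -/
  xe : X
  pt_injective : Function.Injective pt
  pt_mem_extremePoints : ∀ x, pt x ∈ C.extremePoints ℝ
  a_involutive : Function.Involutive a
  b_involutive : Function.Involutive b
  a_ne : ∀ x, a x ≠ x
  b_ne : ∀ x, b x ≠ x
  a_xs : a xs = xe
  isExposed_A : ∀ x, IsExposed ℝ C (A x)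
  isExposed_B : ∀ x, IsExposed ℝ C (B x)
  isClosed_A : ∀ x, IsClosed (A x)
  isClosed_B : ∀ x, IsClosed (B x)
  A_eq : ∀ x, x ≠ xs → x ≠ xe → A x = segment ℝ (pt x) (pt (a x))
  B_eq : ∀ x, B x = segment ℝ (pt x) (pt (b x))
  ray_xs : ∃ d : V, d ≠ 0 ∧ A xs = (fun t : ℝ => pt xs + t • d) '' Set.Ici 0
  ray_xe : ∃ d : V, d ≠ 0 ∧ A xe = (fun t : ℝ => pt xe + t • d) '' Set.Ici 0
  A_inter_B : ∀ x, A x ∩ B x ⊆ {pt x}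
  disjoint_rays : Disjoint (A xs) (A xe)
  eq_iUnion : N = ⋃ x, A x ∪ B x
  linked : ∀ x y p, p ∈ A x ∪ B x → p ∈ A y ∪ B y → Relation.EqvGen (Linked a b) x y

section

variable {V : Type*} [NormedAddCommGroup V] [NormedSpace ℝ V] {C N : Set V}

theorem isEdge_segment {x y : V} (hxy : x ≠ y) (h : IsExposed ℝ C (segment ℝ x y)) :
    IsEdge C (segment ℝ x y) := by
  refine ⟨h, ⟨x, left_mem_segment ℝ x y⟩, ?_⟩
  rw [vectorSpan_segment]
  exact finrank_span_singleton (sub_ne_zero.2 hxy.symm)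

theorem isRayEdge_ray {x d : V} (hd : d ≠ 0) (hx : x ∈ C.extremePoints ℝ)
    (h : IsExposed ℝ C ((fun t : ℝ => x + t • d) '' Set.Ici 0)) :
    IsRayEdge C x ((fun t : ℝ => x + t • d) '' Set.Ici 0) := by
  have hx0 : x ∈ (fun t : ℝ => x + t • d) '' Set.Ici 0 := ⟨0, by simp, by simp⟩
  refine ⟨⟨h, ⟨x, hx0⟩, ?_⟩, hx, d, hd, rfl⟩
  rw [vectorSpan_eq_span_vsub_set_right ℝ hx0]
  have : Submodule.span ℝ ((fun y : V => y -ᵥ x) '' ((fun t : ℝ => x + t • d) '' Set.Ici 0))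
      = ℝ ∙ d := by
    apply le_antisymm
    · rw [Submodule.span_le]
      rintro _ ⟨_, ⟨t, -, rfl⟩, rfl⟩
      simpa using Submodule.smul_mem _ t (Submodule.mem_span_singleton_self d)
    · rw [Submodule.span_singleton_le_iff_mem]
      exact Submodule.subset_span ⟨x + (1 : ℝ) • d, ⟨1, by simp, rfl⟩, by simp⟩
  rw [this]
  exact finrank_span_singleton hd

theorem convex_ray (x d : V) : Convex ℝ ((fun t : ℝ => x + t • d) '' Set.Ici 0) := by
  have : (fun t : ℝ => x + t • d) '' Set.Ici 0
      = (fun z => x + z) '' ((LinearMap.toSpanSingleton ℝ V d) '' Set.Ici 0) := by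
    rw [Set.image_image]; rfl
  rw [this]
  exact ((convex_Ici 0).linear_image _).translate x

namespace EdgePairing

variable {X : Type*} (P : EdgePairing C N X)

theorem a_xe : P.a P.xe = P.xs := by rw [← P.a_xs, P.a_involutive]

theorem a_ne_xs {x : X} (h : x ≠ P.xe) : P.a x ≠ P.xs := fun h' =>
  h (by rw [← P.a_involutive x, h', P.a_xs])

theorem a_ne_xe {x : X} (h : x ≠ P.xs) : P.a x ≠ P.xe := fun h' =>
  h (by rw [← P.a_involutive x, h', P.a_xe])

theorem A_a {x : X} (hs : x ≠ P.xs) (he : x ≠ P.xe) : P.A (P.a x) = P.A x := by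
  rw [P.A_eq x hs he, P.A_eq _ (P.a_ne_xs he) (P.a_ne_xe hs), P.a_involutive, segment_symm]

theorem B_b (x : X) : P.B (P.b x) = P.B x := by
  rw [P.B_eq, P.B_eq x, P.b_involutive, segment_symm]

theorem convex_A (x : X) : Convex ℝ (P.A x) := by
  by_cases hs : x = P.xs
  · obtain ⟨d, -, h⟩ := P.ray_xs
    rw [hs, h]; exact convex_ray _ _
  by_cases he : x = P.xe
  · obtain ⟨d, -, h⟩ := P.ray_xe
    rw [he, h]; exact convex_ray _ _
  rw [P.A_eq x hs he]; exact convex_segment _ _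

theorem convex_B (x : X) : Convex ℝ (P.B x) := by
  rw [P.B_eq]; exact convex_segment _ _

theorem pt_mem_A (x : X) : P.pt x ∈ P.A x := by
  by_cases hs : x = P.xs
  · obtain ⟨d, -, h⟩ := P.ray_xs
    rw [hs, h]; exact ⟨0, by simp, by simp⟩
  by_cases he : x = P.xe
  · obtain ⟨d, -, h⟩ := P.ray_xe
    rw [he, h]; exact ⟨0, by simp, by simp⟩
  rw [P.A_eq x hs he]; exact left_mem_segment _ _ _

theorem pt_mem_B (x : X) : P.pt x ∈ P.B x := by
  rw [P.B_eq]; exact left_mem_segment _ _ _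

theorem A_subset (x : X) : P.A x ⊆ N := fun _ hp => by
  rw [P.eq_iUnion]; exact Set.mem_iUnion.2 ⟨x, Or.inl hp⟩

theorem B_subset (x : X) : P.B x ⊆ N := fun _ hp => by
  rw [P.eq_iUnion]; exact Set.mem_iUnion.2 ⟨x, Or.inr hp⟩

/-- The connected component of a vertex. -/
def comp (x : X) : Set V := connectedComponentIn N (P.pt x)

theorem A_subset_comp (x : X) : P.A x ⊆ P.comp x :=
  (P.convex_A x).isPreconnected.subset_connectedComponentIn (P.pt_mem_A x) (P.A_subset x)

theorem B_subset_comp (x : X) : P.B x ⊆ P.comp x :=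
  (P.convex_B x).isPreconnected.subset_connectedComponentIn (P.pt_mem_B x) (P.B_subset x)

theorem comp_b (x : X) : P.comp (P.b x) = P.comp x := by
  refine (connectedComponentIn_eq (P.B_subset_comp x ?_)).symm
  rw [P.B_eq]; exact right_mem_segment _ _ _

theorem comp_a {x : X} (hs : x ≠ P.xs) (he : x ≠ P.xe) : P.comp (P.a x) = P.comp x := by
  refine (connectedComponentIn_eq (P.A_subset_comp x ?_)).symm
  rw [P.A_eq x hs he]; exact right_mem_segment _ _ _

section path

variable {p : ℕ} (hp : 0 < p) (hret : altSeq P.a P.b P.xs (2 * p) = P.xs)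
  (hinj : ∀ i j, i < 2 * p → j < 2 * p → altSeq P.a P.b P.xs i = altSeq P.a P.b P.xs j → i = j)

include hp hret

/-- The orbit closes up with an `a`-step, which is the artificial link between the two rays. -/
theorem altSeq_last : altSeq P.a P.b P.xs (2 * p - 1) = P.xe := by
  apply P.a_involutive.injective
  rw [P.a_xe, ← altSeq_succ_of_not_even (a := P.a) (b := P.b) (x := P.xs)
      (by rw [Nat.even_sub (by omega)]; simp),
    show 2 * p - 1 + 1 = 2 * p by omega, hret]

include hinj

omit hret in
theorem altSeq_ne_xs {i : ℕ} (h0 : i ≠ 0) (hi : i < 2 * p) : altSeq P.a P.b P.xs i ≠ P.xs :=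
  fun h => h0 (hinj i 0 hi (by omega) h)

theorem altSeq_ne_xe {i : ℕ} (hi : i + 1 < 2 * p) : altSeq P.a P.b P.xs i ≠ P.xe := by
  intro h
  rw [← P.altSeq_last hp hret] at h
  have := hinj i _ (by omega) (by omega) h
  omega

/-- Before the orbit closes it uses only bounded edges, never the artificial link, so each step
stays in the component. -/
theorem comp_altSeq {i : ℕ} (hi : i < 2 * p) : P.comp (altSeq P.a P.b P.xs i) = P.comp P.xs := by
  induction i with
  | zero => rfl
  | succ i ih =>
    by_cases h : Even i
    · rw [altSeq_succ_of_even h, comp_b, ih (by omega)]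
    · rw [altSeq_succ_of_not_even h, comp_a, ih (by omega)]
      · exact P.altSeq_ne_xs hp hinj (by rintro rfl; simp at h) (by omega)
      · exact P.altSeq_ne_xe hp hret hinj hi

theorem path_segment {i : ℕ} (hi : i + 1 < 2 * p) :
    (Even i → P.B (altSeq P.a P.b P.xs i) =
        segment ℝ (P.pt (altSeq P.a P.b P.xs i)) (P.pt (altSeq P.a P.b P.xs (i + 1))) ∧
      P.B (altSeq P.a P.b P.xs (i + 1)) = P.B (altSeq P.a P.b P.xs i)) ∧
    (¬ Even i → P.A (altSeq P.a P.b P.xs i) =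
        segment ℝ (P.pt (altSeq P.a P.b P.xs i)) (P.pt (altSeq P.a P.b P.xs (i + 1))) ∧
      P.A (altSeq P.a P.b P.xs (i + 1)) = P.A (altSeq P.a P.b P.xs i)) := by
  constructor <;> intro h
  · rw [altSeq_succ_of_even h, ← P.B_eq, B_b]
    exact ⟨rfl, rfl⟩
  · have h1 := P.altSeq_ne_xs hp hinj (i := i) (by rintro rfl; simp at h) (by omega)
    have h2 := P.altSeq_ne_xe hp hret hinj hi
    rw [altSeq_succ_of_not_even h, ← P.A_eq _ h1 h2, P.A_a h1 h2]
    exact ⟨rfl, rfl⟩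

end path

/-- The union of the edges at the vertices that are linked to `x`. -/
def part (x : X) : Set V :=
  ⋃ y ∈ {y | Relation.EqvGen (Linked P.a P.b) x y}, P.A y ∪ P.B y

variable {P}

theorem mem_part {x : X} {p : V} : p ∈ P.part x ↔
    ∃ y, Relation.EqvGen (Linked P.a P.b) x y ∧ p ∈ P.A y ∪ P.B y := by
  simp [part]

theorem part_eq {x y : X} (h : Relation.EqvGen (Linked P.a P.b) x y) : P.part x = P.part y := by
  ext p
  simp only [mem_part]
  exact ⟨fun ⟨z, hz, hp⟩ => ⟨z, (h.symm).trans _ _ _ hz, hp⟩,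
    fun ⟨z, hz, hp⟩ => ⟨z, h.trans _ _ _ hz, hp⟩⟩

theorem part_subset (x : X) : P.part x ⊆ N := by
  intro p hp
  obtain ⟨y, -, hy | hy⟩ := mem_part.1 hp
  exacts [P.A_subset y hy, P.B_subset y hy]

theorem rel_of_mem_part {x y : X} {p : V} (hx : p ∈ P.part x) (hy : p ∈ P.part y) :
    Relation.EqvGen (Linked P.a P.b) x y := by
  obtain ⟨x', hx', hpx⟩ := mem_part.1 hx
  obtain ⟨y', hy', hpy⟩ := mem_part.1 hy
  exact (hx'.trans _ _ _ (P.linked x' y' p hpx hpy)).trans _ _ _ hy'.symm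

variable [Finite X]

theorem isClosed_part (x : X) : IsClosed (P.part x) :=
  (Set.toFinite _).isClosed_biUnion fun y _ => (P.isClosed_A y).union (P.isClosed_B y)

/-- The rays are disjoint, so the artificial link proves nothing about connectedness; the long way
around the orbit does. -/
theorem comp_xe : P.comp P.xe = P.comp P.xs := by
  obtain ⟨p, hp, hret, hinj, -⟩ :=
    exists_altSeq_cycle P.a_involutive P.b_involutive P.a_ne P.b_ne P.xs
  rw [← P.altSeq_last hp hret]
  exact P.comp_altSeq hp hret hinj (by omega)

theorem comp_eq_of_rel {x y : X} (h : Relation.EqvGen (Linked P.a P.b) x y) :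
    P.comp x = P.comp y := by
  induction h with
  | rel x y h =>
    rcases h with rfl | rfl
    · by_cases hs : x = P.xs
      · rw [hs, P.a_xs, comp_xe]
      by_cases he : x = P.xe
      · rw [he, P.a_xe, comp_xe]
      exact (P.comp_a hs he).symm
    · exact (P.comp_b x).symm
  | refl => rfl
  | symm _ _ _ ih => exact ih.symm
  | trans _ _ _ _ _ ih1 ih2 => exact ih1.trans ih2

/-- A part lies in the component because its edges chain together. Conversely, it and the finite
union of the other parts are disjoint closed sets covering `N`, so a connected set cannot meet both.
-/
theorem part_eq_comp (x : X) : P.part x = P.comp x := by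
  apply subset_antisymm
  · intro p hp
    obtain ⟨y, hxy, hy⟩ := mem_part.1 hp
    rw [comp_eq_of_rel hxy]
    exact hy.elim (fun h => P.A_subset_comp y h) fun h => P.B_subset_comp y h
  · have hc := isPreconnected_iff_subset_of_disjoint_closed.1
      (isPreconnected_connectedComponentIn (x := P.pt x) (F := N))
      (P.part x) (⋃ y ∈ {y | ¬ Relation.EqvGen (Linked P.a P.b) x y}, P.part y)
      (isClosed_part x) ((Set.toFinite _).isClosed_biUnion fun y _ => isClosed_part y) ?_ ?_
    · refine hc.resolve_right fun h => ?_
      have h1 : P.pt x ∈ N := P.A_subset x (P.pt_mem_A x)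
      obtain ⟨y, hy, hxy⟩ := Set.mem_iUnion₂.1 (h (mem_connectedComponentIn h1))
      exact hy (rel_of_mem_part (mem_part.2 ⟨x, .refl x, Or.inl (P.pt_mem_A x)⟩) hxy)
    · intro p hp
      have := connectedComponentIn_subset _ _ hp
      rw [P.eq_iUnion] at this
      obtain ⟨y, hy⟩ := Set.mem_iUnion.1 this
      by_cases hxy : Relation.EqvGen (Linked P.a P.b) x y
      · exact Or.inl (mem_part.2 ⟨y, hxy, hy⟩)
      · exact Or.inr (Set.mem_iUnion₂.2 ⟨y, hxy, mem_part.2 ⟨y, .refl y, hy⟩⟩)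
    · rw [Set.eq_empty_iff_forall_notMem]
      rintro p ⟨-, hp, hp'⟩
      obtain ⟨y, hy, hxy⟩ := Set.mem_iUnion₂.1 hp'
      exact hy (rel_of_mem_part hp hxy)

theorem connectedComponentIn_eq_part {x : X} {p : V} (hp : p ∈ P.part x) :
    connectedComponentIn N p = P.part x := by
  rw [part_eq_comp] at hp ⊢
  exact (connectedComponentIn_eq hp).symm

/-- The orbit of `xs` is listed from `xs` to `xe`, cut at the artificial link: its `2 * p` vertices
are joined by `2 * p - 1` segments, and the cut leaves a ray at each end. -/
theorem isBiinfinitePath_part : IsBiinfinitePath C (P.A P.xs) (P.A P.xe) (P.part P.xs) := by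
  obtain ⟨p, hp, hret, hinj, hrel⟩ :=
    exists_altSeq_cycle P.a_involutive P.b_involutive P.a_ne P.b_ne P.xs
  have hseg := fun i => P.path_segment hp hret hinj (i := i)
  have hlast := P.altSeq_last hp hret
  set u := altSeq P.a P.b P.xs with hu
  have hu0 : u 0 = P.xs := rfl
  have hsub : ∀ i, i + 1 < 2 * p → P.A (u i) = segment ℝ (P.pt (u i)) (P.pt (u (i + 1))) ∨
      P.B (u i) = segment ℝ (P.pt (u i)) (P.pt (u (i + 1))) := fun i hi => by
    by_cases h : Even i
    · exact Or.inr ((hseg i hi).1 h).1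
    · exact Or.inl ((hseg i hi).2 h).1
  refine ⟨2 * p - 1, fun i => P.pt (u i), ?_, fun i => P.pt_mem_extremePoints _, ?_, ?_, ?_, ?_, ?_⟩
  · intro i j hij
    exact Fin.ext (hinj i j (by omega) (by omega) (P.pt_injective hij))
  · intro i
    apply isEdge_segment
    · intro h
      have := hinj _ _ (by simp; omega) (by simp; omega) (P.pt_injective h)
      simp at this
    · rcases hsub i (by omega) with h | h
      · exact h ▸ P.isExposed_A _
      · exact h ▸ P.isExposed_B _
  · obtain ⟨d, hd, h⟩ := P.ray_xs
    have := P.isExposed_A P.xs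
    simp only [Fin.val_zero, hu0]
    rw [h] at this ⊢
    exact isRayEdge_ray hd (P.pt_mem_extremePoints _) this
  · obtain ⟨d, hd, h⟩ := P.ray_xe
    have := P.isExposed_A P.xe
    simp only [Fin.val_last, hlast]
    rw [h] at this ⊢
    exact isRayEdge_ray hd (P.pt_mem_extremePoints _) this
  · intro h
    have h1 := P.pt_mem_A P.xs
    exact Set.disjoint_left.1 P.disjoint_rays h1 (h ▸ h1)
  · have hmem : ∀ i, i < 2 * p → P.A (u i) ∪ P.B (u i) ⊆ P.part P.xs := fun i hi q hq =>
      mem_part.2 ⟨u i, (hrel _).2 ⟨i, hi, rfl⟩, hq⟩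
    apply subset_antisymm
    · intro q hq
      obtain ⟨y, hy, hqy⟩ := mem_part.1 hq
      obtain ⟨i, hi, rfl⟩ := (hrel y).1 hy
      have hin : ∀ j, j + 1 < 2 * p → q ∈ segment ℝ (P.pt (u j)) (P.pt (u (j + 1))) →
          q ∈ P.A P.xs ∪ (⋃ i : Fin (2 * p - 1), segment ℝ (P.pt (u i.castSucc))
            (P.pt (u i.succ))) ∪ P.A P.xe := fun j hj h =>
        Or.inl (Or.inr (Set.mem_iUnion.2 ⟨⟨j, by omega⟩, h⟩))
      by_cases he : Even i
      · have hi1 : i + 1 < 2 * p := by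
          obtain ⟨r, rfl⟩ := he; omega
        rcases hqy with h | h
        · rcases Nat.eq_zero_or_pos i with rfl | h0
          · exact Or.inl (Or.inl h)
          · obtain ⟨j, rfl⟩ := Nat.exists_eq_succ_of_ne_zero h0.ne'
            have h2 := (hseg j hi).2 (by rw [Nat.succ_eq_add_one, Nat.even_add_one] at he; exact he)
            exact hin j hi (h2.1 ▸ h2.2 ▸ h)
        · exact hin i hi1 (((hseg i hi1).1 he).1 ▸ h)
      · rcases hqy with h | h
        · by_cases hi1 : i + 1 < 2 * p
          · exact hin i hi1 (((hseg i hi1).2 he).1 ▸ h)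
          · obtain rfl : i = 2 * p - 1 := by omega
            exact Or.inr (hlast ▸ h)
        · obtain ⟨j, rfl⟩ := Nat.exists_eq_succ_of_ne_zero (n := i) (by rintro rfl; simp at he)
          have h2 := (hseg j hi).1 (by
            rw [Nat.succ_eq_add_one, Nat.even_add_one, not_not] at he; exact he)
          exact hin j hi (h2.1 ▸ h2.2 ▸ h)
    · rintro q ((h | h) | h)
      · exact hmem 0 (by omega) (Or.inl h)
      · obtain ⟨i, hi⟩ := Set.mem_iUnion.1 h
        rcases hsub i (by omega) with h | h
        · exact hmem i (by omega) (Or.inl (h ▸ hi))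
        · exact hmem i (by omega) (Or.inr (h ▸ hi))
      · exact hmem (2 * p - 1) (by omega) (Or.inl (hlast ▸ h))

theorem isEdgeCycle_part {x : X} (hx : ¬ Relation.EqvGen (Linked P.a P.b) P.xs x) :
    IsEdgeCycle C (P.part x) := by
  obtain ⟨p, hp, hret, hinj, hrel⟩ :=
    exists_altSeq_cycle P.a_involutive P.b_involutive P.a_ne P.b_ne x
  have hs : ∀ y, Relation.EqvGen (Linked P.a P.b) x y → y ≠ P.xs := by
    rintro y hy rfl
    exact hx hy.symm
  have he : ∀ y, Relation.EqvGen (Linked P.a P.b) x y → y ≠ P.xe := by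
    rintro y hy rfl
    exact hx ((Relation.EqvGen.rel P.xs P.xe (Or.inl P.a_xs.symm)).trans _ _ _ hy.symm)
  have hsucc : ∀ i, (Even i → altSeq P.a P.b x (i + 1) = P.b (altSeq P.a P.b x i)) ∧
      (¬ Even i → altSeq P.a P.b x (i + 1) = P.a (altSeq P.a P.b x i)) := fun i =>
    ⟨altSeq_succ_of_even, altSeq_succ_of_not_even⟩
  have hu0 : altSeq P.a P.b x 0 = x := rfl
  generalize altSeq P.a P.b x = u at *
  have hA : ∀ i < 2 * p, P.A (u i) = segment ℝ (P.pt (u i)) (P.pt (P.a (u i))) := fun i hi =>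
    P.A_eq _ (hs _ ((hrel _).2 ⟨i, hi, rfl⟩)) (he _ ((hrel _).2 ⟨i, hi, rfl⟩))
  have hsub : ∀ i < 2 * p, P.A (u i) = segment ℝ (P.pt (u i)) (P.pt (u (i + 1))) ∨
      P.B (u i) = segment ℝ (P.pt (u i)) (P.pt (u (i + 1))) := fun i hi => by
    by_cases h : Even i
    · rw [(hsucc i).1 h]; exact Or.inr (P.B_eq _)
    · rw [(hsucc i).2 h]; exact Or.inl (hA i hi)
  -- With `p = 1` the edges `A x` and `B x` would share both endpoints, against `A_inter_B`.
  have hp2 : 2 ≤ p := by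
    by_contra! hlt
    obtain rfl : p = 1 := by omega
    have h1 := (hsucc 0).1 (by simp)
    have h2 := (hsucc 1).2 (by simp)
    rw [show 1 + 1 = 2 * 1 from rfl, hret, h1, hu0] at h2
    have h3 : P.b x ≠ x := P.b_ne x
    have h4 : P.a x = P.b x := by rw [h2, P.a_involutive, ← h2]
    have h5 := P.A_inter_B x ⟨?_, P.B_eq x ▸ right_mem_segment _ _ _⟩
    · exact h3 (P.pt_injective h5)
    · rw [P.A_eq x (hs x (.refl x)) (he x (.refl x)), h4]
      exact right_mem_segment _ _ _
  obtain ⟨k, hk⟩ : ∃ k, k + 3 = 2 * p := ⟨2 * p - 3, by omega⟩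
  have hwrap : ∀ i : Fin (k + 3), u ((i + 1 : Fin (k + 3)) : ℕ) = u (i + 1) := by
    intro i
    rw [Fin.val_add_one]
    split_ifs with h
    · rw [hu0, h, Fin.val_last, show k + 2 + 1 = 2 * p from hk, hret]
    · rfl
  refine ⟨k, fun i => P.pt (u i), ?_, fun i => P.pt_mem_extremePoints _, ?_, ?_⟩
  · intro i j hij
    exact Fin.ext (hinj i j (by omega) (by omega) (P.pt_injective hij))
  · intro i
    apply isEdge_segment
    · intro h
      have h1 := P.pt_injective h
      rw [hwrap] at h1
      by_cases hev : Even (i : ℕ)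
      · rw [(hsucc i).1 hev] at h1
        exact P.b_ne _ h1.symm
      · rw [(hsucc i).2 hev] at h1
        exact P.a_ne _ h1.symm
    · simp only [hwrap]
      rcases hsub i (by omega) with h | h
      · exact h ▸ P.isExposed_A _
      · exact h ▸ P.isExposed_B _
  · simp only [hwrap]
    have hin : ∀ j < 2 * p, ∀ q ∈ segment ℝ (P.pt (u j)) (P.pt (u (j + 1))),
        q ∈ ⋃ i : Fin (k + 3), segment ℝ (P.pt (u i)) (P.pt (u (i + 1))) := fun j hj q h =>
      Set.mem_iUnion.2 ⟨⟨j, by omega⟩, h⟩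
    apply subset_antisymm
    · intro q hq
      obtain ⟨y, hy, hqy⟩ := mem_part.1 hq
      obtain ⟨i, hi, rfl⟩ := (hrel y).1 hy
      by_cases hev : Even i
      · rcases hqy with h | h
        · obtain ⟨j, hj, hja⟩ : ∃ j < 2 * p, u (j + 1) = u i ∧ ¬ Even j := by
            rcases Nat.eq_zero_or_pos i with rfl | h0
            · refine ⟨2 * p - 1, by omega, ?_, by rw [Nat.even_sub (by omega)]; simp⟩
              rw [show 2 * p - 1 + 1 = 2 * p by omega, hret, hu0]
            · obtain ⟨j, rfl⟩ := Nat.exists_eq_succ_of_ne_zero h0.ne'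
              exact ⟨j, by omega, rfl, by
                rw [Nat.succ_eq_add_one, Nat.even_add_one] at hev; exact hev⟩
          refine hin j hj q ?_
          rw [hja.1, segment_symm]
          rw [hA i hi] at h
          have : P.a (u i) = u j := by rw [← hja.1, (hsucc j).2 hja.2, P.a_involutive]
          rwa [this] at h
        · refine hin i hi q ?_
          rw [(hsucc i).1 hev, ← P.B_eq]
          exact h
      · rcases hqy with h | h
        · refine hin i hi q ?_
          rw [(hsucc i).2 hev, ← hA i hi]
          exact h
        · obtain ⟨j, rfl⟩ := Nat.exists_eq_succ_of_ne_zero (n := i) (by rintro rfl; simp at hev)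
          refine hin j (by omega) q ?_
          rw [Nat.succ_eq_add_one, Nat.even_add_one, not_not] at hev
          rw [Nat.succ_eq_add_one, (hsucc j).1 hev, B_b, P.B_eq] at h
          rw [(hsucc j).1 hev]
          exact h
    · intro q h
      obtain ⟨i, hi⟩ := Set.mem_iUnion.1 h
      refine mem_part.2 ⟨u i, (hrel _).2 ⟨i, by omega, rfl⟩, ?_⟩
      rcases hsub i (by omega) with h | h
      · exact Or.inl (h ▸ hi)
      · exact Or.inr (h ▸ hi)

variable (P) in
-- The cycles are indexed by the orbits other than that of `xs`.
theorem exists_path_and_cycles : ∃ (path : Set V) (k : ℕ) (cyc : Fin k → Set V),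
    IsBiinfinitePath C (P.A P.xs) (P.A P.xe) path ∧
    (∀ i, IsEdgeCycle C (cyc i)) ∧
    N = path ∪ ⋃ i, cyc i ∧
    (∀ i, Disjoint path (cyc i)) ∧
    (∀ i i', i ≠ i' → Disjoint (cyc i) (cyc i')) ∧
    (∀ p ∈ path, connectedComponentIn N p = path) ∧
    (∀ i, ∀ p ∈ cyc i, connectedComponentIn N p = cyc i) := by
  classical
  let r := Relation.EqvGen.setoid (Linked P.a P.b)
  have hr : ∀ x y, Relation.EqvGen (Linked P.a P.b) x y ↔ (⟦x⟧ : Quotient r) = ⟦y⟧ :=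
    fun x y => (Quotient.eq (r := r)).symm
  let I := {q : Quotient r // q ≠ ⟦P.xs⟧}
  have : Finite I := inferInstance
  obtain ⟨k, ⟨e⟩⟩ := Finite.exists_equiv_fin I
  let rep : Fin k → X := fun i => (e.symm i).1.out
  have hrep : ∀ i, (⟦rep i⟧ : Quotient r) = (e.symm i).1 := fun i => Quotient.out_eq _
  refine ⟨P.part P.xs, k, fun i => P.part (rep i), isBiinfinitePath_part,
    fun i => isEdgeCycle_part ?_, ?_, fun i => ?_, fun i i' hii => ?_,
    fun p hp => connectedComponentIn_eq_part hp, fun i p hp => connectedComponentIn_eq_part hp⟩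
  · rw [hr, hrep]
    exact (e.symm i).2.symm
  · apply subset_antisymm
    · intro p hp
      rw [P.eq_iUnion] at hp
      obtain ⟨x, hx⟩ := Set.mem_iUnion.1 hp
      have hpx : p ∈ P.part x := mem_part.2 ⟨x, .refl x, hx⟩
      by_cases h : (⟦x⟧ : Quotient r) = ⟦P.xs⟧
      · exact Or.inl (part_eq ((hr _ _).2 h) ▸ hpx)
      · refine Or.inr (Set.mem_iUnion.2 ⟨e ⟨⟦x⟧, h⟩, ?_⟩)
        have : P.part x = P.part (rep (e ⟨⟦x⟧, h⟩)) := part_eq ((hr _ _).2 (by rw [hrep]; simp))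
        exact this ▸ hpx
    · exact Set.union_subset (part_subset _) (Set.iUnion_subset fun i => part_subset _)
  · rw [Set.disjoint_left]
    intro p hp hp'
    have := (hr _ _).1 (rel_of_mem_part hp hp')
    rw [hrep] at this
    exact (e.symm i).2 this.symm
  · rw [Set.disjoint_left]
    intro p hp hp'
    have := (hr _ _).1 (rel_of_mem_part hp hp')
    rw [hrep, hrep] at this
    exact hii (e.symm.injective (Subtype.ext this))

end EdgePairing

end

end Polyhedral

/-! ### Fully labeled points of a polyhedron with paired inequalities. -/

namespace Polyhedral

open Module

/-- The graph of a choice of one of the two inequalities that carry the label `l`, for each `l`. -/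
def choiceGraph {Λ : Type*} (τ : Λ → Bool) : Set (Bool × Λ) := {e | τ e.2 = e.1}

section

variable {Λ : Type*}

theorem mem_choiceGraph {τ : Λ → Bool} {e : Bool × Λ} : e ∈ choiceGraph τ ↔ τ e.2 = e.1 := Iff.rfl

theorem ncard_choiceGraph [Fintype Λ] (τ : Λ → Bool) :
    (choiceGraph τ).ncard = Fintype.card Λ := by
  have : choiceGraph τ = Set.range fun l => (τ l, l) := by
    ext ⟨c, l⟩
    simp [mem_choiceGraph]
  rw [this, ← Set.image_univ, Set.ncard_image_of_injective _ fun l l' h => (Prod.ext_iff.1 h).2,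
    Set.ncard_univ, Nat.card_eq_fintype_card]

theorem choiceGraph_injective : Function.Injective (choiceGraph (Λ := Λ)) := fun τ _ h =>
  funext fun l => ((Set.ext_iff.1 h (τ l, l)).1 rfl).symm

/-- The parity of the number of labels at which a choice is `true`. -/
def parity [Fintype Λ] (τ : Λ → Bool) : ZMod 2 := ∑ l, if τ l then 1 else 0

theorem parity_update [Fintype Λ] [DecidableEq Λ] (τ : Λ → Bool) (l : Λ) :
    parity (Function.update τ l (!τ l)) = parity τ + 1 := by
  unfold parity
  rw [← Finset.add_sum_erase _ _ (Finset.mem_univ l),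
    ← Finset.add_sum_erase (a := l) Finset.univ (fun l => if τ l then (1 : ZMod 2) else 0)
      (Finset.mem_univ l)]
  rw [Finset.sum_congr rfl (g := fun l => if τ l then (1 : ZMod 2) else 0)]
  · have : ∀ s : ZMod 2, s = 1 + s + 1 := by decide
    cases h : τ l
    · simp [add_comm]
    · simpa using this _
  · intro k hk
    rw [Function.update_of_ne (Finset.ne_of_mem_erase hk)]

end

theorem isBounded_segment {V : Type*} [NormedAddCommGroup V] [NormedSpace ℝ V] (x y : V) :
    Bornology.IsBounded (segment ℝ x y) := by
  rw [segment_eq_image_lineMap]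
  exact (isCompact_Icc.image AffineMap.lineMap_continuous).isBounded

theorem not_isBounded_of_ray {V : Type*} [NormedAddCommGroup V] [NormedSpace ℝ V] {x d : V}
    (hd : d ≠ 0) {F : Set V} (h : ∀ t : ℝ, 0 ≤ t → x + t • d ∈ F) :
    ¬ Bornology.IsBounded F := by
  intro hb
  obtain ⟨R, hR⟩ := hb.exists_norm_le
  have hd' : 0 < ‖d‖ := norm_pos_iff.2 hd
  have h0 : ‖x‖ ≤ R := by simpa using hR _ (h 0 le_rfl)
  have hR0 : 0 ≤ R := (norm_nonneg x).trans h0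
  -- Chosen so that the displacement has norm `2 * R + 1`, more than two points of a ball of radius
  -- `R` can be apart.
  have h1 := hR _ (h ((2 * R + 1) / ‖d‖) (by positivity))
  have h2 : ‖((2 * R + 1) / ‖d‖) • d‖ = 2 * R + 1 := by
    rw [norm_smul, Real.norm_of_nonneg (by positivity), div_mul_cancel₀ _ hd'.ne']
  have h3 := norm_sub_le (x + ((2 * R + 1) / ‖d‖) • d) x
  rw [add_sub_cancel_left, h2] at h3
  linarith

namespace SimplePolyhedron

variable {V Λ : Type*} [NormedAddCommGroup V] [NormedSpace ℝ V]

/-- The points at which one of the two inequalities with label `l` is tight, for each `l`. -/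
def fullyLabeled (S : SimplePolyhedron V (Bool × Λ)) : Set V :=
  {x ∈ S.carrier | ∀ l, ∃ c, (c, l) ∈ S.tight x}

/-- The vertices of the set of fully labeled points. -/
def LabeledVertex (S : SimplePolyhedron V (Bool × Λ)) : Type _ :=
  {x : V // S.IsVertex x ∧ x ∈ S.fullyLabeled}

/-- The face of the fully labeled points that is given by a choice of tight inequalities. -/
def choiceFace (S : SimplePolyhedron V (Bool × Λ)) (τ : Λ → Bool) : Set V :=
  S.face (choiceGraph τ)

variable {S : SimplePolyhedron V (Bool × Λ)}

theorem mem_choiceFace {τ : Λ → Bool} {x : V} :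
    x ∈ S.choiceFace τ ↔ x ∈ S.carrier ∧ choiceGraph τ ⊆ S.tight x := Iff.rfl

theorem choiceFace_subset (τ : Λ → Bool) : S.choiceFace τ ⊆ S.fullyLabeled :=
  fun _ hx => ⟨hx.1, fun l => ⟨τ l, hx.2 rfl⟩⟩

theorem exists_mem_choiceFace {x : V} (hx : x ∈ S.fullyLabeled) : ∃ τ, x ∈ S.choiceFace τ := by
  choose τ hτ using hx.2
  refine ⟨τ, hx.1, ?_⟩
  rintro ⟨c, l⟩ hc
  have hc : τ l = c := hc
  exact hc ▸ hτ l

variable [Fintype Λ] [FiniteDimensional ℝ V]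

/-- A vertex is determined by its set of tight inequalities. -/
instance : Finite S.LabeledVertex :=
  Finite.of_injective (fun x => S.tight x.1) fun x y (h : S.tight x.1 = S.tight y.1) =>
    Subtype.ext (y.2.1.eq_of_subset x.2.1.1 h.ge)

variable (hdim : finrank ℝ S.dir = Fintype.card Λ + 1)

include hdim

omit [FiniteDimensional ℝ V] in
-- The dimension exceeds the number of labels by one, so one tight inequality is left over; it can
-- only be the unchosen twin at its label.
theorem IsVertex.exists_tight_eq_insert {x : V} (hx : S.IsVertex x) {τ : Λ → Bool}
    (hτ : x ∈ S.choiceFace τ) : ∃ l, S.tight x = insert (!τ l, l) (choiceGraph τ) := by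
  have hcard : (choiceGraph τ).ncard < (S.tight x).ncard := by
    rw [hx.2, hdim, ncard_choiceGraph]; omega
  obtain ⟨⟨c, l⟩, he, hn⟩ := Set.exists_mem_notMem_of_ncard_lt_ncard hcard
  have hc : c = !τ l := by
    have h : τ l ≠ c := hn
    revert h; cases c <;> cases τ l <;> simp
  subst hc
  refine ⟨l, (Set.eq_of_subset_of_ncard_le (Set.insert_subset he hτ.2) ?_).symm⟩
  rw [Set.ncard_insert_of_notMem hn, ncard_choiceGraph, hx.2, hdim]

theorem IsVertex.choiceFace_eq {x : V} (hx : S.IsVertex x) {τ : Λ → Bool}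
    (hτ : x ∈ S.choiceFace τ) :
    (∃ d, d ≠ 0 ∧ S.choiceFace τ = (fun t : ℝ => x + t • d) '' Set.Ici 0) ∨
    ∃ y, S.IsVertex y ∧ y ≠ x ∧ S.choiceFace τ = segment ℝ x y := by
  obtain ⟨l, hl⟩ := hx.exists_tight_eq_insert hdim hτ
  have hn : (!τ l, l) ∉ choiceGraph τ := by simp [mem_choiceGraph]
  have h := hx.face_diff_singleton (e := (!τ l, l)) (by rw [hl]; exact Set.mem_insert _ _)
  rwa [hl, Set.insert_sdiff_self_of_notMem hn] at h

omit [FiniteDimensional ℝ V] in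
/-- A vertex lies in exactly one edge of each parity. -/
theorem LabeledVertex.existsUnique_parity (x : S.LabeledVertex) (κ : ZMod 2) :
    ∃! τ, x.1 ∈ S.choiceFace τ ∧ parity τ = κ := by
  classical
  obtain ⟨τ, hτ⟩ := exists_mem_choiceFace x.2.2
  obtain ⟨l, hl⟩ := x.2.1.exists_tight_eq_insert hdim hτ
  -- Only the duplicated label `l` leaves a choice, and flipping it changes the parity.
  have hmem : ∀ σ, x.1 ∈ S.choiceFace σ ↔ σ = τ ∨ σ = Function.update τ l (!τ l) := by
    intro σ
    rw [mem_choiceFace, hl, and_iff_right x.2.1.1]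
    constructor
    · intro h
      have hne : ∀ k ≠ l, σ k = τ k := fun k hk => by
        rcases h (show (σ k, k) ∈ choiceGraph σ from rfl) with h | h
        · exact absurd (Prod.ext_iff.1 h).2 hk
        · exact h.symm
      by_cases h1 : σ l = τ l
      · left
        funext k
        by_cases hk : k = l
        · rw [hk, h1]
        · exact hne k hk
      · right
        funext k
        by_cases hk : k = l
        · subst hk
          rw [Function.update_self]
          revert h1; cases σ k <;> cases τ k <;> simp
        · rw [Function.update_of_ne hk, hne k hk]
    · rintro (rfl | rfl)
      · exact Set.subset_insert _ _
      · rintro ⟨c, k⟩ hk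
        have hk : Function.update τ l (!τ l) k = c := hk
        by_cases hkl : k = l
        · subst hkl
          rw [Function.update_self] at hk
          exact Or.inl (by rw [hk])
        · rw [Function.update_of_ne hkl] at hk
          exact Or.inr hk
  have hpar := parity_update τ l
  have h2 : ∀ s κ : ZMod 2, s = κ ∨ s + 1 = κ := by decide
  have h3 : ∀ s : ZMod 2, s + 1 ≠ s := by decide
  rcases h2 (parity τ) κ with h | h
  · refine ⟨τ, ⟨(hmem τ).2 (Or.inl rfl), h⟩, ?_⟩
    rintro σ ⟨hσ, hσκ⟩
    rcases (hmem σ).1 hσ with rfl | rfl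
    · rfl
    · exact absurd (by rw [← hpar, hσκ, h]) (h3 (parity τ))
  · refine ⟨_, ⟨(hmem _).2 (Or.inr rfl), hpar.trans h⟩, ?_⟩
    rintro σ ⟨hσ, hσκ⟩
    rcases (hmem σ).1 hσ with rfl | rfl
    · exact absurd (by rw [h, hσκ]) (h3 (parity σ))
    · rfl

omit [FiniteDimensional ℝ V] in
-- Two different choices impose at least one inequality more than there are labels, so their edges
-- can meet only in a vertex.
theorem ncard_union_choiceGraph {σ τ : Λ → Bool} (h : σ ≠ τ) :
    finrank ℝ S.dir ≤ (choiceGraph σ ∪ choiceGraph τ).ncard := by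
  rw [hdim, Nat.succ_le_iff, ← ncard_choiceGraph σ]
  refine Set.ncard_lt_ncard (Set.subset_union_left.ssubset_of_ne fun heq => h ?_)
  apply choiceGraph_injective
  refine (Set.eq_of_subset_of_ncard_le (heq ▸ Set.subset_union_right) ?_).symm
  rw [ncard_choiceGraph, ncard_choiceGraph]

omit [FiniteDimensional ℝ V] in
theorem isVertex_of_mem_of_mem {σ τ : Λ → Bool} (h : σ ≠ τ) {x : V} (hσ : x ∈ S.choiceFace σ)
    (hτ : x ∈ S.choiceFace τ) : S.IsVertex x :=
  isVertex_of_le hσ.1 ((ncard_union_choiceGraph hdim h).trans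
    (Set.ncard_le_ncard (Set.union_subset hσ.2 hτ.2)))

theorem eq_of_mem_of_mem {σ τ : Λ → Bool} (h : σ ≠ τ) {x y : V} (hσ : x ∈ S.choiceFace σ)
    (hτ : x ∈ S.choiceFace τ) (hσ' : y ∈ S.choiceFace σ) (hτ' : y ∈ S.choiceFace τ) : y = x := by
  have hx := isVertex_of_mem_of_mem hdim h hσ hτ
  refine hx.eq_of_subset hσ'.1 ?_
  rw [← Set.eq_of_subset_of_ncard_le (Set.union_subset hσ.2 hτ.2)
    (hx.2.trans_le (ncard_union_choiceGraph hdim h))]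
  exact Set.union_subset hσ'.2 hτ'.2

omit hdim in
theorem exists_labeledVertex_mem {τ : Λ → Bool} {x : V} (hx : x ∈ S.choiceFace τ) :
    ∃ y : S.LabeledVertex, y.1 ∈ S.choiceFace τ := by
  obtain ⟨y, hy, hxy⟩ := exists_isVertex_superset hx.1
  have : y ∈ S.choiceFace τ := ⟨hy.1, hx.2.trans hxy⟩
  exact ⟨⟨y, hy, choiceFace_subset τ this⟩, this⟩

omit hdim in
theorem LabeledVertex.eq_or_eq {x y z : S.LabeledVertex} {τ : Λ → Bool}
    (h : S.choiceFace τ = segment ℝ x.1 y.1) (hz : z.1 ∈ S.choiceFace τ) : z = x ∨ z = y := by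
  have hx : x.1 ∈ S.choiceFace τ := h ▸ left_mem_segment _ _ _
  have hy : y.1 ∈ S.choiceFace τ := h ▸ right_mem_segment _ _ _
  rw [h, ← insert_endpoints_openSegment] at hz
  rcases hz with hz | hz | hz
  · exact Or.inl (Subtype.ext hz)
  · exact Or.inr (Subtype.ext hz)
  · have := (mem_extremePoints.1 z.2.1.mem_extremePoints).2 x.1 hx.1 y.1 hy.1 hz
    exact Or.inl (Subtype.ext this.1.symm)

omit hdim in
theorem LabeledVertex.eq_of_ray {x z : S.LabeledVertex} {τ : Λ → Bool} {d : V}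
    (h : S.choiceFace τ = (fun t : ℝ => x.1 + t • d) '' Set.Ici 0) (hz : z.1 ∈ S.choiceFace τ) :
    z = x := by
  have hx : x.1 ∈ S.choiceFace τ := h ▸ ⟨0, by simp, by simp⟩
  rw [h] at hz
  obtain ⟨t, ht, hzt⟩ := hz
  -- This makes `z` the midpoint of two points of the ray; being extreme, it equals the endpoint.
  have hy : x.1 + (2 * t) • d ∈ S.choiceFace τ := h ▸ ⟨2 * t, by
    have : 0 ≤ t := ht
    simpa using this, rfl⟩
  have := (mem_extremePoints.1 z.2.1.mem_extremePoints).2 x.1 hx.1 _ hy.1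
    ⟨1 / 2, 1 / 2, by norm_num, by norm_num, by norm_num, by rw [← hzt]; module⟩
  exact Subtype.ext this.1.symm

/-- The edge of given parity at a vertex. -/
noncomputable def edgeChoice (x : S.LabeledVertex) (κ : ZMod 2) : Λ → Bool :=
  (x.existsUnique_parity hdim κ).choose

omit [FiniteDimensional ℝ V] in
theorem mem_edgeChoice (x : S.LabeledVertex) (κ : ZMod 2) :
    x.1 ∈ S.choiceFace (edgeChoice hdim x κ) := (x.existsUnique_parity hdim κ).choose_spec.1.1

omit [FiniteDimensional ℝ V] in
theorem parity_edgeChoice (x : S.LabeledVertex) (κ : ZMod 2) :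
    parity (edgeChoice hdim x κ) = κ := (x.existsUnique_parity hdim κ).choose_spec.1.2

omit [FiniteDimensional ℝ V] in
theorem eq_edgeChoice {x : S.LabeledVertex} {κ : ZMod 2} {τ : Λ → Bool}
    (h : x.1 ∈ S.choiceFace τ) (hκ : parity τ = κ) : τ = edgeChoice hdim x κ :=
  (x.existsUnique_parity hdim κ).choose_spec.2 τ ⟨h, hκ⟩

open Classical in
/-- The other end of the edge of given parity at a vertex. -/
noncomputable def otherEnd (κ : ZMod 2) (x : S.LabeledVertex) : S.LabeledVertex :=
  if h : ∃ y : S.LabeledVertex, y ≠ x ∧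
    S.choiceFace (edgeChoice hdim x κ) = segment ℝ x.1 y.1 then h.choose else x

theorem otherEnd_spec {κ : ZMod 2} {x : S.LabeledVertex}
    (h : ¬ ∃ d, d ≠ 0 ∧
      S.choiceFace (edgeChoice hdim x κ) = (fun t : ℝ => x.1 + t • d) '' Set.Ici 0) :
    otherEnd hdim κ x ≠ x ∧
      S.choiceFace (edgeChoice hdim x κ) = segment ℝ x.1 (otherEnd hdim κ x).1 := by
  obtain ⟨y, hy, hyx, heq⟩ := (x.2.1.choiceFace_eq hdim (mem_edgeChoice hdim x κ)).resolve_left h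
  have hy' : y ∈ S.choiceFace (edgeChoice hdim x κ) := heq ▸ right_mem_segment _ _ _
  have hex : ∃ y : S.LabeledVertex, y ≠ x ∧
      S.choiceFace (edgeChoice hdim x κ) = segment ℝ x.1 y.1 :=
    ⟨⟨y, hy, choiceFace_subset _ hy'⟩, fun h => hyx (congrArg Subtype.val h), heq⟩
  rw [otherEnd, dif_pos hex]
  exact hex.choose_spec

omit [FiniteDimensional ℝ V] in
theorem edgeChoice_otherEnd {κ : ZMod 2} {x : S.LabeledVertex}
    (h : S.choiceFace (edgeChoice hdim x κ) = segment ℝ x.1 (otherEnd hdim κ x).1) :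
    edgeChoice hdim (otherEnd hdim κ x) κ = edgeChoice hdim x κ :=
  (eq_edgeChoice hdim (h ▸ right_mem_segment _ _ _) (parity_edgeChoice hdim x κ)).symm

theorem otherEnd_otherEnd {κ : ZMod 2} {x : S.LabeledVertex}
    (h : ¬ ∃ d, d ≠ 0 ∧
      S.choiceFace (edgeChoice hdim x κ) = (fun t : ℝ => x.1 + t • d) '' Set.Ici 0)  :
    otherEnd hdim κ (otherEnd hdim κ x) = x := by
  obtain ⟨h1, h2⟩ := otherEnd_spec hdim h
  have h3 := edgeChoice_otherEnd hdim h2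
  have h4 : ¬ ∃ d, d ≠ 0 ∧ S.choiceFace (edgeChoice hdim (otherEnd hdim κ x) κ) =
      (fun t : ℝ => (otherEnd hdim κ x).1 + t • d) '' Set.Ici 0 := by
    rintro ⟨d, -, hd⟩
    rw [h3] at hd
    exact h1 (LabeledVertex.eq_of_ray hd (mem_edgeChoice hdim x κ)).symm
  obtain ⟨h5, h6⟩ := otherEnd_spec hdim h4
  rw [h3] at h6
  refine (LabeledVertex.eq_or_eq h2 (h6 ▸ right_mem_segment _ _ _)).resolve_right h5

variable {τs τe : Λ → Bool}
  (hray : ∀ τ x d, d ≠ 0 → (∀ t : ℝ, 0 ≤ t → x + t • d ∈ S.choiceFace τ) → τ = τs ∨ τ = τe)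

/-- The face contains a vertex, and being unbounded it is not a segment. -/
theorem exists_ray {τ : Λ → Bool}
    (h : ∃ x d, d ≠ 0 ∧ ∀ t : ℝ, 0 ≤ t → x + t • d ∈ S.choiceFace τ) :
    ∃ x : S.LabeledVertex, ∃ d, d ≠ 0 ∧
      S.choiceFace τ = (fun t : ℝ => x.1 + t • d) '' Set.Ici 0 := by
  obtain ⟨x, d, hd, hxd⟩ := h
  obtain ⟨y, hy⟩ := exists_labeledVertex_mem (hxd 0 le_rfl)
  refine ⟨y, (y.2.1.choiceFace_eq hdim hy).resolve_right ?_⟩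
  rintro ⟨z, -, -, h⟩
  exact not_isBounded_of_ray hd hxd (h ▸ isBounded_segment _ _)

include hray

/-- `A` consists of the edges with the parity of the two rays and `B` of the others, which are all
bounded. Equal parity is what allows one involution to exchange the two ray vertices. -/
theorem exists_edgePairing (hne : τs ≠ τe) (hpar : parity τs = parity τe)
    (hs : ∃ x d, d ≠ 0 ∧ ∀ t : ℝ, 0 ≤ t → x + t • d ∈ S.choiceFace τs)
    (he : ∃ x d, d ≠ 0 ∧ ∀ t : ℝ, 0 ≤ t → x + t • d ∈ S.choiceFace τe) :
    ∃ P : EdgePairing S.carrier S.fullyLabeled S.LabeledVertex,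
      P.A P.xs = S.choiceFace τs ∧ P.A P.xe = S.choiceFace τe := by
  classical
  obtain ⟨xs, ds, hds, hxs⟩ := exists_ray hdim hs
  obtain ⟨xe, de, hde, hxe⟩ := exists_ray hdim he
  have hxsm : xs.1 ∈ S.choiceFace τs := hxs ▸ ⟨0, by simp, by simp⟩
  have hxem : xe.1 ∈ S.choiceFace τe := hxe ▸ ⟨0, by simp, by simp⟩
  set κ := parity τs
  have hτs : edgeChoice hdim xs κ = τs := (eq_edgeChoice hdim hxsm rfl).symm
  have hτe : edgeChoice hdim xe κ = τe := (eq_edgeChoice hdim hxem hpar.symm).symm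
  have hκne : ∀ κ : ZMod 2, κ + 1 ≠ κ := by decide
  have hκor : ∀ κ κ' : ZMod 2, κ' = κ ∨ κ' = κ + 1 := by decide
  have hxse : xs ≠ xe := by
    rintro rfl
    exact hne (hτs.symm.trans hτe)
  have hnotray : ∀ κ' x, (∃ d, d ≠ 0 ∧
      S.choiceFace (edgeChoice hdim x κ') = (fun t : ℝ => x.1 + t • d) '' Set.Ici 0) →
      κ' = κ ∧ (x = xs ∨ x = xe) := by
    rintro κ' x ⟨d, hd, h⟩
    have hp := parity_edgeChoice hdim x κ'
    rcases hray (edgeChoice hdim x κ') x.1 d hd fun t ht => h ▸ ⟨t, ht, rfl⟩ with h' | h'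
    · refine ⟨by rw [← hp, h'], Or.inl ?_⟩
      rw [h'] at h
      exact (LabeledVertex.eq_of_ray h hxsm).symm
    · refine ⟨by rw [← hp, h', hpar], Or.inr ?_⟩
      rw [h'] at h
      exact (LabeledVertex.eq_of_ray h hxem).symm
  have hB : ∀ x, ¬ ∃ d, d ≠ 0 ∧ S.choiceFace (edgeChoice hdim x (κ + 1)) =
      (fun t : ℝ => x.1 + t • d) '' Set.Ici 0 := fun x h => hκne κ (hnotray _ x h).1
  have hA : ∀ x, x ≠ xs → x ≠ xe → ¬ ∃ d, d ≠ 0 ∧ S.choiceFace (edgeChoice hdim x κ) =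
      (fun t : ℝ => x.1 + t • d) '' Set.Ici 0 := fun x h h' h'' =>
    (hnotray _ x h'').2.elim h h'
  let a : S.LabeledVertex → S.LabeledVertex := fun x =>
    if x = xs then xe else if x = xe then xs else otherEnd hdim κ x
  have has : a xs = xe := if_pos rfl
  have hae : a xe = xs := by simp [a, hxse.symm]
  have hao : ∀ x, x ≠ xs → x ≠ xe → a x = otherEnd hdim κ x := fun x h h' => by
    simp [a, h, h']
  -- Otherwise the edge from `x` would be the only edge of parity `κ` at `xs`, a ray with no other
  -- vertex. The same holds for `xe`.
  have hos : ∀ x, x ≠ xs → x ≠ xe → otherEnd hdim κ x ≠ xs := by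
    intro x h h' h''
    have h2 := (otherEnd_spec hdim (hA x h h')).2
    have h3 := edgeChoice_otherEnd hdim h2
    rw [h'', hτs] at h3
    rw [← h3] at h2
    exact h (LabeledVertex.eq_of_ray hxs (h2 ▸ left_mem_segment _ _ _))
  have hoe : ∀ x, x ≠ xs → x ≠ xe → otherEnd hdim κ x ≠ xe := by
    intro x h h' h''
    have h2 := (otherEnd_spec hdim (hA x h h')).2
    have h3 := edgeChoice_otherEnd hdim h2
    rw [h'', hτe] at h3
    rw [← h3] at h2
    exact h' (LabeledVertex.eq_of_ray hxe (h2 ▸ left_mem_segment _ _ _))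
  let b := otherEnd hdim (κ + 1)
  have hedge : ∀ (x : S.LabeledVertex) τ, x.1 ∈ S.choiceFace τ →
      τ = edgeChoice hdim x κ ∨ τ = edgeChoice hdim x (κ + 1) := fun x τ h =>
    (hκor κ (parity τ)).imp (eq_edgeChoice hdim h) (eq_edgeChoice hdim h)
  have hsame : ∀ τ (x y : S.LabeledVertex), x.1 ∈ S.choiceFace τ → y.1 ∈ S.choiceFace τ →
      Relation.EqvGen (Linked a b) x y := by
    intro τ x y hx hy
    rcases hedge x τ hx with rfl | rfl
    · by_cases h : x = xs
      · rw [h, hτs] at hy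
        rw [h, LabeledVertex.eq_of_ray hxs hy]
        exact .refl _
      by_cases h' : x = xe
      · rw [h', hτe] at hy
        rw [h', LabeledVertex.eq_of_ray hxe hy]
        exact .refl _
      rcases LabeledVertex.eq_or_eq (otherEnd_spec hdim (hA x h h')).2 hy with rfl | h''
      · exact .refl _
      · exact .rel _ _ (Or.inl (by rw [h'', hao x h h']))
    · rcases LabeledVertex.eq_or_eq (otherEnd_spec hdim (hB x)).2 hy with rfl | h''
      · exact .refl _
      · exact .rel _ _ (Or.inr h'')
  have hAB : ∀ x, edgeChoice hdim x κ ≠ edgeChoice hdim x (κ + 1) := fun x h => by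
    have := congrArg parity h
    rw [parity_edgeChoice, parity_edgeChoice] at this
    exact hκne κ this.symm
  have hlinked : ∀ σ τ (x y : S.LabeledVertex) p, x.1 ∈ S.choiceFace σ → y.1 ∈ S.choiceFace τ →
      p ∈ S.choiceFace σ → p ∈ S.choiceFace τ → Relation.EqvGen (Linked a b) x y := by
    intro σ τ x y p hx hy hpx hpy
    by_cases h : σ = τ
    · subst h
      exact hsame σ x y hx hy
    -- Edges of different choices meet only in a vertex, which lies on both and links `x` to `y`.
    · let q : S.LabeledVertex :=
        ⟨p, isVertex_of_mem_of_mem hdim h hpx hpy, choiceFace_subset _ hpx⟩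
      exact (hsame σ x q hx hpx).trans _ _ _ (hsame τ q y hpy hy)
  refine ⟨{ pt := Subtype.val
            A := fun x => S.choiceFace (edgeChoice hdim x κ)
            B := fun x => S.choiceFace (edgeChoice hdim x (κ + 1))
            a := a
            b := b
            xs := xs
            xe := xe
            pt_injective := Subtype.val_injective
            pt_mem_extremePoints := fun x => x.2.1.mem_extremePoints
            a_involutive := fun x => ?_
            b_involutive := fun x => otherEnd_otherEnd hdim (hB x)
            a_ne := fun x => ?_
            b_ne := fun x => (otherEnd_spec hdim (hB x)).1
            a_xs := has
            isExposed_A := fun x => isExposed_face _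
            isExposed_B := fun x => isExposed_face _
            isClosed_A := fun x => isClosed_face _
            isClosed_B := fun x => isClosed_face _
            A_eq := fun x h h' => ?_
            B_eq := fun x => (otherEnd_spec hdim (hB x)).2
            ray_xs := ⟨ds, hds, by rw [hτs, hxs]⟩
            ray_xe := ⟨de, hde, by rw [hτe, hxe]⟩
            A_inter_B := fun x y hy => eq_of_mem_of_mem hdim (hAB x) (mem_edgeChoice hdim x κ)
              (mem_edgeChoice hdim x (κ + 1)) hy.1 hy.2
            disjoint_rays := ?_
            eq_iUnion := ?_
            linked := fun x y p hx hy => ?_ }, ?_, ?_⟩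
  · by_cases h : x = xs
    · rw [h, has, hae]
    by_cases h' : x = xe
    · rw [h', hae, has]
    rw [hao x h h', hao _ (hos x h h') (hoe x h h'), otherEnd_otherEnd hdim (hA x h h')]
  · by_cases h : x = xs
    · rw [h, has]; exact hxse.symm
    by_cases h' : x = xe
    · rw [h', hae]; exact hxse
    rw [hao x h h']
    exact (otherEnd_spec hdim (hA x h h')).1
  · rw [hao x h h']
    exact (otherEnd_spec hdim (hA x h h')).2
  · rw [hτs, hτe, Set.disjoint_left]
    intro p hp hp'
    let q : S.LabeledVertex := ⟨p, isVertex_of_mem_of_mem hdim hne hp hp', choiceFace_subset _ hp⟩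
    exact hxse ((LabeledVertex.eq_of_ray (z := q) hxs hp).symm.trans
      (LabeledVertex.eq_of_ray (z := q) hxe hp'))
  · apply subset_antisymm
    · intro p hp
      obtain ⟨τ, hτ⟩ := exists_mem_choiceFace hp
      obtain ⟨y, hy⟩ := exists_labeledVertex_mem hτ
      refine Set.mem_iUnion.2 ⟨y, ?_⟩
      rcases hedge y τ hy with rfl | rfl
      · exact Or.inl hτ
      · exact Or.inr hτ
    · exact Set.iUnion_subset fun x =>
        Set.union_subset (choiceFace_subset _) (choiceFace_subset _)
  · rcases hx with hx | hx <;> rcases hy with hy | hy <;>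
      exact hlinked _ _ x y p (mem_edgeChoice hdim _ _) (mem_edgeChoice hdim _ _) hx hy
  · simp only [hτs]
  · simp only [hτe]

end SimplePolyhedron

end Polyhedral

/-! ### The polyhedron P × Q' of a game space and its unbounded edges. -/

namespace GameSpace

open Module Polyhedral

variable {m n : ℕ} (G : GameSpace m n)

/-- The left hand sides of the inequalities of `P × Q'`, written with right hand side `0`. -/
def ineq : Bool × (Fin m ⊕ Fin n) → ((Fin n → ℝ) × ℝ) × ((Fin m → ℝ) × ℝ × ℝ) →ₗ[ℝ] ℝ
  | (true, .inl i) =>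
    { toFun := fun p => G.A.mulVec p.1.1 i - p.1.2
      map_add' := fun p q => by simp [Matrix.mulVec_add]; ring
      map_smul' := fun c p => by simp [Matrix.mulVec_smul]; ring }
  | (true, .inr j) =>
    { toFun := fun p => -p.1.1 j
      map_add' := fun p q => by simp; ring
      map_smul' := fun c p => by simp }
  | (false, .inl i) =>
    { toFun := fun p => -p.2.1 i
      map_add' := fun p q => by simp; ring
      map_smul' := fun c p => by simp }
  | (false, .inr j) =>
    { toFun := fun p => Matrix.vecMul p.2.1 G.C j + G.β j * p.2.2.1 - p.2.2.2
      map_add' := fun p q => by simp [Matrix.add_vecMul]; ring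
      map_smul' := fun c p => by simp [Matrix.smul_vecMul]; ring }

@[simp] theorem ineq_true_inl (i : Fin m) (p : ((Fin n → ℝ) × ℝ) × ((Fin m → ℝ) × ℝ × ℝ)) :
    G.ineq (true, .inl i) p = G.A.mulVec p.1.1 i - p.1.2 := rfl

@[simp] theorem ineq_true_inr (j : Fin n) (p : ((Fin n → ℝ) × ℝ) × ((Fin m → ℝ) × ℝ × ℝ)) :
    G.ineq (true, .inr j) p = -p.1.1 j := rfl

@[simp] theorem ineq_false_inl (i : Fin m) (p : ((Fin n → ℝ) × ℝ) × ((Fin m → ℝ) × ℝ × ℝ)) :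
    G.ineq (false, .inl i) p = -p.2.1 i := rfl

@[simp] theorem ineq_false_inr (j : Fin n) (p : ((Fin n → ℝ) × ℝ) × ((Fin m → ℝ) × ℝ × ℝ)) :
    G.ineq (false, .inr j) p = Matrix.vecMul p.2.1 G.C j + G.β j * p.2.2.1 - p.2.2.2 := rfl

/-- The sums of the entries of the two mixed strategies. -/
def sums (m n : ℕ) : ((Fin n → ℝ) × ℝ) × ((Fin m → ℝ) × ℝ × ℝ) →ₗ[ℝ] ℝ × ℝ where
  toFun p := (∑ j, p.1.1 j, ∑ i, p.2.1 i)
  map_add' p q := by simp [Finset.sum_add_distrib]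
  map_smul' c p := by simp [Finset.mul_sum]

theorem mem_ker_sums {p : ((Fin n → ℝ) × ℝ) × ((Fin m → ℝ) × ℝ × ℝ)} :
    p ∈ LinearMap.ker (sums m n) ↔ ∑ j, p.1.1 j = 0 ∧ ∑ i, p.2.1 i = 0 := by
  rw [LinearMap.mem_ker]
  exact Prod.ext_iff

theorem mem_prod_iff {p : ((Fin n → ℝ) × ℝ) × ((Fin m → ℝ) × ℝ × ℝ)} :
    p ∈ G.P ×ˢ G.Q' ↔ (∀ i, G.ineq i p ≤ 0) ∧ ∑ j, p.1.1 j = 1 ∧ ∑ i, p.2.1 i = 1 := by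
  constructor
  · rintro ⟨⟨h1, h2, h3⟩, h4, h5, h6⟩
    refine ⟨?_, h3, h6⟩
    rintro ⟨_ | _, i | j⟩
    · simpa using h4 i
    · simpa using h5 j
    · simpa using h1 i
    · simpa using h2 j
  · rintro ⟨h, h1, h2⟩
    exact ⟨⟨fun i => by simpa using h (true, .inl i), fun j => by simpa using h (true, .inr j), h1⟩,
      fun i => by simpa using h (false, .inl i), fun j => by simpa using h (false, .inr j), h2⟩

theorem ineq_true_eq_zero_iff {l : Fin m ⊕ Fin n} {p : ((Fin n → ℝ) × ℝ) × ((Fin m → ℝ) × ℝ × ℝ)} :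
    G.ineq (true, l) p = 0 ↔ l ∈ G.labelP p.1 := by
  rcases l with i | j
  · simp [labelP, sub_eq_zero]
  · simp [labelP]

theorem ineq_false_eq_zero_iff {l : Fin m ⊕ Fin n}
    {p : ((Fin n → ℝ) × ℝ) × ((Fin m → ℝ) × ℝ × ℝ)} :
    G.ineq (false, l) p = 0 ↔ l ∈ G.labelQ' p.2 := by
  rcases l with i | j
  · simp [labelQ']
  · simp [labelQ', sub_eq_zero]

theorem nonempty_rows (G : GameSpace m n) : Nonempty (Fin m) := by
  by_contra h
  rw [not_nonempty_iff] at h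
  exact G.A_ne_zero (Subsingleton.elim _ _)

theorem nonempty_columns (G : GameSpace m n) : Nonempty (Fin n) := by
  by_contra h
  rw [not_nonempty_iff] at h
  exact G.A_ne_zero (Matrix.ext fun _ j => h.elim j)

theorem finrank_ker_sums (G : GameSpace m n) : finrank ℝ (LinearMap.ker (sums m n)) = m + n + 1 := by
  have i0 := G.nonempty_rows
  have j0 := G.nonempty_columns
  have hsurj : LinearMap.range (sums m n) = ⊤ := by
    rw [LinearMap.range_eq_top]
    rintro ⟨s, t⟩
    exact ⟨((Pi.single (Classical.arbitrary _) s, 0), (Pi.single (Classical.arbitrary _) t, 0, 0)),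
      by simp [sums]⟩
  have h := LinearMap.finrank_range_add_finrank_ker (sums m n)
  rw [hsurj, finrank_top] at h
  simp at h
  omega

/-- The polyhedron `P × Q'`, with the two inequalities that carry a label as a pair. -/
noncomputable def polyhedron (hP : G.NondegenerateP) (hQ : G.NondegenerateQ')
    (hβ : ∃ j k, G.β j ≠ G.β k) :
    SimplePolyhedron (((Fin n → ℝ) × ℝ) × ((Fin m → ℝ) × ℝ × ℝ)) (Bool × (Fin m ⊕ Fin n)) where
  carrier := G.P ×ˢ G.Q'
  dir := LinearMap.ker (sums m n)
  g := G.ineq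
  b := 0
  mem_iff x hx y := by
    rw [mem_prod_iff] at hx ⊢
    rw [mem_ker_sums, and_comm]
    simp [hx.2.1, hx.2.2, sub_eq_zero]
  pointed d hd h := by
    obtain ⟨i0⟩ := G.nonempty_rows
    obtain ⟨⟨dy, dp⟩, dx, dl, dq⟩ := d
    have hy : dy = 0 := funext fun j => by simpa using h (true, .inr j)
    have hx : dx = 0 := funext fun i => by simpa using h (false, .inl i)
    have hp : dp = 0 := by simpa [hy] using h (true, .inl i0)
    -- Two different entries of `β` are needed to exclude a line in the (λ, π₂)-plane.
    obtain ⟨j, k, hjk⟩ := hβ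
    have hj : G.β j * dl - dq = 0 := by simpa [hx] using h (false, .inr j)
    have hk : G.β k * dl - dq = 0 := by simpa [hx] using h (false, .inr k)
    have hl : dl = 0 := by
      have : (G.β j - G.β k) * dl = 0 := by linarith
      exact (mul_eq_zero.1 this).resolve_left (sub_ne_zero.2 hjk)
    have hq : dq = 0 := by simpa [hl] using hj
    simp [hy, hx, hp, hl, hq]
  card_le x hx := by
    have : {i | G.ineq i x = (0 : Bool × (Fin m ⊕ Fin n) → ℝ) i} =
        Prod.mk true '' G.labelP x.1 ∪ Prod.mk false '' G.labelQ' x.2 := by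
      ext ⟨_ | _, l⟩
      · simp [ineq_false_eq_zero_iff]
      · simp [ineq_true_eq_zero_iff]
    rw [this, G.finrank_ker_sums]
    refine (Set.ncard_union_le _ _).trans ?_
    rw [Set.ncard_image_of_injective _ (Prod.mk_right_injective _),
      Set.ncard_image_of_injective _ (Prod.mk_right_injective _)]
    have := hP x.1 hx.1
    have := hQ x.2 hx.2
    omega

section

variable {G} {hP : G.NondegenerateP} {hQ : G.NondegenerateQ'} {hβ : ∃ j k, G.β j ≠ G.β k}

theorem finrank_dir_polyhedron :
    finrank ℝ (G.polyhedron hP hQ hβ).dir = Fintype.card (Fin m ⊕ Fin n) + 1 := by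
  rw [Fintype.card_sum, Fintype.card_fin, Fintype.card_fin]
  exact G.finrank_ker_sums

theorem fullyLabeled_polyhedron : (G.polyhedron hP hQ hβ).fullyLabeled = G.N := by
  ext p
  constructor
  · rintro ⟨hp, h⟩
    refine ⟨hp.1, hp.2, Set.eq_univ_of_forall fun l => ?_⟩
    obtain ⟨c, hc⟩ := h l
    cases c
    · exact Or.inr (G.ineq_false_eq_zero_iff.1 hc)
    · exact Or.inl (G.ineq_true_eq_zero_iff.1 hc)
  · rintro ⟨h1, h2, h⟩
    refine ⟨⟨h1, h2⟩, fun l => ?_⟩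
    rcases Set.eq_univ_iff_forall.1 h l with h | h
    · exact ⟨true, G.ineq_true_eq_zero_iff.2 h⟩
    · exact ⟨false, G.ineq_false_eq_zero_iff.2 h⟩

theorem mem_choiceFace_polyhedron {τ : Fin m ⊕ Fin n → Bool}
    {p : ((Fin n → ℝ) × ℝ) × ((Fin m → ℝ) × ℝ × ℝ)} :
    p ∈ (G.polyhedron hP hQ hβ).choiceFace τ ↔
      p.1 ∈ G.P ∧ p.2 ∈ G.Q' ∧ (∀ l, τ l = true → l ∈ G.labelP p.1) ∧
        ∀ l, τ l = false → l ∈ G.labelQ' p.2 := by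
  constructor
  · rintro ⟨h1, h2⟩
    exact ⟨h1.1, h1.2, fun l hl => G.ineq_true_eq_zero_iff.1 (h2 (a := (true, l)) hl),
      fun l hl => G.ineq_false_eq_zero_iff.1 (h2 (a := (false, l)) hl)⟩
  · rintro ⟨h1, h2, h3, h4⟩
    refine ⟨⟨h1, h2⟩, ?_⟩
    rintro ⟨_ | _, l⟩ hl
    · exact G.ineq_false_eq_zero_iff.2 (h4 l hl)
    · exact G.ineq_true_eq_zero_iff.2 (h3 l hl)

end

theorem mulVec_single_one (i : Fin m) (j : Fin n) :
    G.A.mulVec (Pi.single j 1) i = G.A i j := by simp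

theorem exists_max_row (j : Fin n) : ∃ i, (∀ k, G.A k j ≤ G.A i j) ∧ ⨆ k, G.A k j = G.A i j := by
  have := G.nonempty_rows
  obtain ⟨i, hi⟩ := Finite.exists_max fun k => G.A k j
  exact ⟨i, hi, le_antisymm (ciSup_le hi)
    (le_ciSup (f := fun k => G.A k j) (Set.finite_range _).bddAbove i)⟩

theorem pureVertex_mem (j : Fin n) : G.pureVertex j ∈ G.P := by
  refine ⟨fun i => ?_, fun k => ?_, by simp [pureVertex]⟩
  · rw [pureVertex, mulVec_single_one]
    exact le_ciSup (f := fun k => G.A k j) (Set.finite_range _).bddAbove i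
  · simp only [pureVertex, Pi.single_apply]
    split_ifs <;> norm_num

theorem inl_mem_labelP_pureVertex {i : Fin m} {j : Fin n} :
    Sum.inl i ∈ G.labelP (G.pureVertex j) ↔ G.A i j = ⨆ k, G.A k j := by
  simp [labelP, pureVertex]

theorem inr_mem_labelP_pureVertex {j k : Fin n} :
    Sum.inr k ∈ G.labelP (G.pureVertex j) ↔ k ≠ j := by
  simp [labelP, pureVertex, Pi.single_apply]

variable {G}

theorem ncard_insert_columns (i : Fin m) (j : Fin n) :
    (insert (Sum.inl i) (Sum.inr '' {j}ᶜ) : Set (Fin m ⊕ Fin n)).ncard = n := by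
  rw [Set.ncard_insert_of_notMem (by simp), Set.ncard_image_of_injective _ Sum.inr_injective,
    Set.ncard_compl, Set.ncard_singleton, Nat.card_eq_fintype_card, Fintype.card_fin]
  have := j.pos
  omega

/-- The n - 1 unused columns and one best row already exhaust the n labels that non-degeneracy
allows; in particular the best row is unique. -/
theorem labelP_pureVertex (hP : G.NondegenerateP) {i : Fin m} {j : Fin n}
    (hi : Sum.inl i ∈ G.labelP (G.pureVertex j)) :
    G.labelP (G.pureVertex j) = insert (Sum.inl i) (Sum.inr '' {j}ᶜ) := by
  refine (Set.eq_of_subset_of_ncard_le (Set.insert_subset hi ?_) ?_).symm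
  · rintro _ ⟨k, hk, rfl⟩
    exact (G.inr_mem_labelP_pureVertex).2 hk
  · rw [ncard_insert_columns]
    exact hP _ (G.pureVertex_mem j)

theorem ncard_labelP_pureVertex (hP : G.NondegenerateP) (j : Fin n) :
    (G.labelP (G.pureVertex j)).ncard = n := by
  obtain ⟨i, -, hi⟩ := G.exists_max_row j
  rw [labelP_pureVertex hP ((G.inl_mem_labelP_pureVertex).2 hi.symm), ncard_insert_columns]

/-- A point of `P` with `y` a unit vector and a tight row is a `pureVertex`. -/
theorem eq_pureVertex {v : (Fin n → ℝ) × ℝ} (hv : v ∈ G.P) {j : Fin n}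
    (hj : ∀ k, k ≠ j → v.1 k = 0) {i : Fin m} (hi : Sum.inl i ∈ G.labelP v) :
    v = G.pureVertex j := by
  obtain ⟨y, p⟩ := v
  obtain ⟨h1, -, h3⟩ := hv
  have hy : y = Pi.single j 1 := by
    funext k
    by_cases hk : k = j
    · subst hk
      rw [Finset.sum_eq_single k (fun l _ hl => hj l hl) (by simp)] at h3
      simpa using h3
    · rw [Pi.single_eq_of_ne hk]
      exact hj k hk
  subst hy
  have hi : G.A.mulVec (Pi.single j 1) i = p := hi
  have h1 : ∀ k, G.A.mulVec (Pi.single j 1) k ≤ p := h1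
  rw [mulVec_single_one] at hi
  simp only [mulVec_single_one] at h1
  have := G.nonempty_rows
  refine Prod.ext rfl (le_antisymm ?_ (ciSup_le h1))
  rw [← hi]
  exact le_ciSup (f := fun k => G.A k j) (Set.finite_range _).bddAbove i

variable (G) in
open Classical in
/-- The choice of the inequalities of `P` for the labels of a `pureVertex`. -/
noncomputable def pureChoice (j : Fin n) : Fin m ⊕ Fin n → Bool :=
  fun l => decide (l ∈ G.labelP (G.pureVertex j))

theorem pureChoice_eq_true {j : Fin n} {l : Fin m ⊕ Fin n} :
    G.pureChoice j l = true ↔ l ∈ G.labelP (G.pureVertex j) := by simp [pureChoice]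

theorem pureChoice_eq_false {j : Fin n} {l : Fin m ⊕ Fin n} :
    G.pureChoice j l = false ↔ l ∉ G.labelP (G.pureVertex j) := by simp [pureChoice]

theorem parity_pureChoice (hP : G.NondegenerateP) (j : Fin n) :
    parity (G.pureChoice j) = n := by
  classical
  simp only [parity, pureChoice_eq_true]
  have h := ncard_labelP_pureVertex hP j
  rw [Set.ncard_eq_toFinset_card'] at h
  rw [Finset.sum_boole, Set.filter_mem_univ_eq_toFinset, h]

theorem pureChoice_injective : Function.Injective (G.pureChoice) := by
  intro j k h
  by_contra hjk
  have := congrFun h (Sum.inr j)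
  rw [(pureChoice_eq_true).2 ((G.inr_mem_labelP_pureVertex).2 hjk), pureChoice_eq_false.2] at this
  · exact absurd this (by simp)
  · simp [inr_mem_labelP_pureVertex]

variable {hP : G.NondegenerateP} {hQ : G.NondegenerateQ'} {hβ : ∃ j k, G.β j ≠ G.β k}

theorem choiceFace_pureChoice (j : Fin n) :
    (G.polyhedron hP hQ hβ).choiceFace (G.pureChoice j) =
      {G.pureVertex j} ×ˢ G.fiber (G.pureVertex j) := by
  ext ⟨v, w⟩
  rw [mem_choiceFace_polyhedron]
  constructor
  · rintro ⟨hv, hw, h1, h2⟩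
    obtain ⟨i, -, hi⟩ := G.exists_max_row j
    have hveq : v = G.pureVertex j := by
      refine eq_pureVertex hv (fun k hk => ?_)
        (h1 (Sum.inl i) (pureChoice_eq_true.2 (G.inl_mem_labelP_pureVertex.2 hi.symm)))
      exact h1 (Sum.inr k) (pureChoice_eq_true.2 (G.inr_mem_labelP_pureVertex.2 hk))
    subst hveq
    refine ⟨rfl, hv, hw, Set.eq_univ_of_forall fun l => ?_⟩
    by_cases hl : l ∈ G.labelP (G.pureVertex j)
    · exact Or.inl hl
    · exact Or.inr (h2 l (pureChoice_eq_false.2 hl))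
  · rintro ⟨rfl, hv, hw, h⟩
    refine ⟨hv, hw, fun l hl => pureChoice_eq_true.1 hl, fun l hl => ?_⟩
    exact (Set.eq_univ_iff_forall.1 h l).resolve_left (pureChoice_eq_false.1 hl)

/-- Let `x` be the best row against `j` and send λ to infinity with the sign of `s`: column `j`
eventually beats all others, and raising π₂ along with it keeps `j` tight. -/
theorem exists_ray_pureChoice {j : Fin n} {s : ℝ} (hs : s ≠ 0)
    (hj : ∀ k, k ≠ j → G.β k * s < G.β j * s) :
    ∃ x d, d ≠ 0 ∧ ∀ t : ℝ, 0 ≤ t →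
      x + t • d ∈ (G.polyhedron hP hQ hβ).choiceFace (G.pureChoice j) := by
  obtain ⟨i, -, hi⟩ := G.exists_max_row j
  have hil := G.inl_mem_labelP_pureVertex.2 hi.symm
  -- The quotient is the threshold beyond which `j` does at least as well as `k`. For `k = j` it is
  -- 0 / 0 = 0, which is harmless.
  obtain ⟨L, hL⟩ := (Set.finite_range fun k =>
    (G.C i k - G.C i j) / (G.β j * s - G.β k * s)).bddAbove
  refine ⟨(G.pureVertex j, (Pi.single i 1, L * s, G.C i j + G.β j * (L * s))),
    (0, (0, s, G.β j * s)), by simp [hs], fun t ht => ?_⟩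
  rw [choiceFace_pureChoice]
  have hv : ∀ k, Matrix.vecMul (Pi.single i 1) G.C k = G.C i k := fun k => by simp
  refine ⟨by simp, ?_⟩
  simp only [fiber, N, Set.mem_ofPred_eq, Prod.smul_mk, Prod.mk_add_mk, smul_zero, add_zero,
    smul_eq_mul]
  refine ⟨G.pureVertex_mem j, ⟨fun k => ?_, fun k => ?_, by simp⟩,
    Set.eq_univ_of_forall fun l => ?_⟩
  · simp only [Pi.single_apply]
    split_ifs <;> norm_num
  · simp only [hv]
    by_cases hk : k = j
    · subst hk
      exact le_of_eq (by ring)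
    · have h1 : _ ≤ L := hL (Set.mem_range_self k)
      have h2 := hj k hk
      rw [div_le_iff₀ (by linarith)] at h1
      nlinarith
  · rcases l with k | k
    · by_cases hk : k = i
      · exact Or.inl (hk ▸ hil)
      · exact Or.inr (by simp [labelQ', hk])
    · by_cases hk : k = j
      · refine Or.inr ?_
        subst hk
        simp only [labelQ', Set.mem_ofPred_eq, Sum.elim_inr, hv]
        ring
      · exact Or.inl (G.inr_mem_labelP_pureVertex.2 hk)

/-- In a recession direction the strategy parts are nonnegative with sum 0, hence zero, and some row
tight in P fixes π₁. What remains is (dl, dq) with dq the maximum of `β j * dl`, and the sign of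
`dl` decides which column attains it. -/
theorem eq_pureChoice_of_ray {js je : Fin n} (hjs : ∀ j, j ≠ js → G.β js < G.β j)
    (hje : ∀ j, j ≠ je → G.β j < G.β je) {τ : Fin m ⊕ Fin n → Bool}
    {x d : ((Fin n → ℝ) × ℝ) × ((Fin m → ℝ) × ℝ × ℝ)} (hd : d ≠ 0)
    (h : ∀ t : ℝ, 0 ≤ t → x + t • d ∈ (G.polyhedron hP hQ hβ).choiceFace τ) :
    τ = G.pureChoice js ∨ τ = G.pureChoice je := by
  have hx := h 0 le_rfl
  rw [zero_smul, add_zero] at hx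
  have hsum : d ∈ LinearMap.ker (sums m n) := by
    have := SimplePolyhedron.sub_mem hx.1 (h 1 zero_le_one).1
    rwa [one_smul, add_sub_cancel_left] at this
  rw [mem_ker_sums] at hsum
  have hle : ∀ e, G.ineq e d ≤ 0 := by
    intro e
    by_contra! hpos
    have h0 := (G.mem_prod_iff.1 hx.1).1 e
    -- At this time the left hand side would equal 1, violating the bound 0.
    have h1 := (G.mem_prod_iff.1 (h ((1 - G.ineq e x) / G.ineq e d)
      (div_nonneg (by linarith) hpos.le)).1).1 e
    rw [map_add, map_smul, smul_eq_mul, div_mul_cancel₀ _ hpos.ne'] at h1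
    linarith
  have hzero : ∀ l, G.ineq (τ l, l) d = 0 := by
    intro l
    have h0 : G.ineq (τ l, l) x = 0 := hx.2 (show (τ l, l) ∈ choiceGraph τ from rfl)
    have h1 : G.ineq (τ l, l) (x + (1 : ℝ) • d) = 0 := 
      (h 1 zero_le_one).2 (show (τ l, l) ∈ choiceGraph τ from rfl)
    simpa [h0] using h1
  rw [mem_choiceFace_polyhedron] at hx
  obtain ⟨⟨dy, dp⟩, dx, dl, dq⟩ := d
  obtain ⟨⟨y, p⟩, x, l, q⟩ := x
  obtain ⟨hxP, hxQ, hxt, hxf⟩ := hx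
  have hdy : dy = 0 := by
    have h1 : ∀ j, 0 ≤ dy j := fun j => by simpa using hle (true, .inr j)
    exact funext fun j => (Finset.sum_eq_zero_iff_of_nonneg fun j _ => h1 j).1 hsum.1 j (by simp)
  have hdx : dx = 0 := by
    have h1 : ∀ i, 0 ≤ dx i := fun i => by simpa using hle (false, .inl i)
    exact funext fun i => (Finset.sum_eq_zero_iff_of_nonneg fun i _ => h1 i).1 hsum.2 i (by simp)
  subst hdy hdx
  -- Otherwise every `x i` is zero, against the sum being 1. The same argument for `y` yields `j0`
  -- below.
  obtain ⟨i, hi⟩ : ∃ i, τ (.inl i) = true := by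
    by_contra! hall
    have h0 : ∀ i, x i = 0 := fun i => hxf (.inl i) (by simpa using hall i)
    have h1 : ∑ i, x i = 1 := hxQ.2.2
    simp [h0] at h1
  have hdp : dp = 0 := by
    have := hzero (.inl i)
    rw [hi] at this
    simpa using this
  subst hdp
  have hcol : ∀ j, τ (.inr j) = false → G.β j * dl = dq := fun j hj => by
    have := hzero (.inr j)
    rw [hj] at this
    simpa [sub_eq_zero] using this
  have hcolle : ∀ j, G.β j * dl ≤ dq := fun j => by simpa using hle (false, .inr j)
  obtain ⟨j0, hj0⟩ : ∃ j, τ (.inr j) = false := by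
    by_contra! hall
    have h0 : ∀ j, y j = 0 := fun j => hxt (.inr j) (by simpa using hall j)
    have h1 : ∑ j, y j = 1 := hxP.2.2
    simp [h0] at h1
  -- Only the strict maximizer can stay tight in Q', so all other columns are unused and the point
  -- of P is a `pureVertex`; its unique best row then determines τ on the rows.
  have key : ∀ j, (∀ k, k ≠ j → G.β k * dl < G.β j * dl) → τ = G.pureChoice j := by
    intro j hj
    have hτ : ∀ k, τ (.inr k) = true ↔ k ≠ j := by
      have hne : ∀ k, k ≠ j → τ (.inr k) = true := fun k hk => by
        by_contra hf
        have := hcol k (by simpa using hf)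
        have := hcolle j
        have := hj k hk
        linarith
      refine fun k => ⟨?_, hne k⟩
      rintro hk rfl
      have : j0 = k := by
        by_contra h0
        rw [hne j0 h0] at hj0
        exact absurd hj0 (by simp)
      rw [this, hk] at hj0
      exact absurd hj0 (by simp)
    have hv : (y, p) = G.pureVertex j :=
      eq_pureVertex hxP (fun k hk => hxt (.inr k) ((hτ k).2 hk)) (hxt _ hi)
    have hlab := labelP_pureVertex hP (hv ▸ hxt _ hi)
    funext l
    rw [Bool.eq_iff_iff, pureChoice_eq_true]
    rcases l with k | k
    · constructor
      · intro hk
        exact hv ▸ hxt _ hk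
      · rw [hlab]
        rintro (hk | ⟨_, _, hk⟩)
        · exact hk ▸ hi
        · exact absurd hk (by simp)
    · rw [hτ, inr_mem_labelP_pureVertex]
  rcases lt_trichotomy dl 0 with hl | hl | hl
  · exact Or.inl (key js fun k hk => mul_lt_mul_of_neg_right (hjs k hk) hl)
  · have := hcol j0 hj0
    subst hl
    rw [mul_zero] at this
    subst this
    exact absurd rfl hd
  · exact Or.inr (key je fun k hk => mul_lt_mul_of_pos_right (hje k hk) hl)

end GameSpace

theorem mainTheorem5 {m n : ℕ} (G : GameSpace m n)
    (hP : G.NondegenerateP) (hQ : G.NondegenerateQ')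
    (js je : Fin n) (hne : js ≠ je)
    (hjs : ∀ j, j ≠ js → G.β js < G.β j) (hje : ∀ j, j ≠ je → G.β j < G.β je) :
    ∃ (path : Set (((Fin n → ℝ) × ℝ) × ((Fin m → ℝ) × ℝ × ℝ))) (k : ℕ)
      (cyc : Fin k → Set (((Fin n → ℝ) × ℝ) × ((Fin m → ℝ) × ℝ × ℝ))),
      Polyhedral.IsBiinfinitePath (G.P ×ˢ G.Q')
        ({G.pureVertex js} ×ˢ G.fiber (G.pureVertex js))
        ({G.pureVertex je} ×ˢ G.fiber (G.pureVertex je)) path ∧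
      (∀ i, Polyhedral.IsEdgeCycle (G.P ×ˢ G.Q') (cyc i)) ∧
      G.N = path ∪ ⋃ i, cyc i ∧
      (∀ i, Disjoint path (cyc i)) ∧
      (∀ i i', i ≠ i' → Disjoint (cyc i) (cyc i')) ∧
      (∀ p ∈ path, connectedComponentIn G.N p = path) ∧
      (∀ i, ∀ p ∈ cyc i, connectedComponentIn G.N p = cyc i) := by
  have hβ : ∃ j k, G.β j ≠ G.β k := ⟨js, je, (hjs je hne.symm).ne⟩
  obtain ⟨E, hs, he⟩ := Polyhedral.SimplePolyhedron.exists_edgePairing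
    (S := G.polyhedron hP hQ hβ) GameSpace.finrank_dir_polyhedron
    (fun _ _ _ hd h => GameSpace.eq_pureChoice_of_ray hjs hje hd h)
    (GameSpace.pureChoice_injective.ne hne)
    ((GameSpace.parity_pureChoice hP js).trans (GameSpace.parity_pureChoice hP je).symm)
    -- Letting λ tend to -∞ favours the column with the smallest `β`.
    (GameSpace.exists_ray_pureChoice (s := -1) (by norm_num) fun k hk => by
      have := hjs k hk
      linarith)
    (GameSpace.exists_ray_pureChoice (s := 1) (by norm_num) fun k hk => by
      have := hje k hk
      linarith)
  have h := E.exists_path_and_cycles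
  rw [hs, he, GameSpace.choiceFace_pureChoice, GameSpace.choiceFace_pureChoice,
    GameSpace.fullyLabeled_polyhedron] at h
  exact h
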